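/- A one-clock timed automaton (1-TA) over a finite alphabet $\Sigma$ is a tuple $\mathcal A=(Q,q_I,T,F)$ with a finite set of states $Q$, an initial state $q_I$, final states $F\subseteq Q$, and a finite set $T$ of transitions $(q,q',a,\phi,r)$, where $a\in\Sigma$, $r\in\{0,1\}$, and the guard $\phi$ is a non-empty finite conjunction of constraints $c<x$, $x=c$, $x<c$ with $c\in\mathbb N$, defining a set $[\![\phi]\!]\subseteq\mathbb R_{\ge0}$. A timed word is a finite sequence $(t_1\cdot a_1)\cdots(t_n\cdot a_n)$ with $t_i\in\mathbb R_{\ge 0}$ and $a_i\in\Sigma$. From a configuration $(q,\nu)$, reading $(t\cdot a)$, a transition $(q,q',a,\phi,r)$ with $\nu+t\in[\![\phi]\!]$ leads to $(q',r(\nu+t))$; runs start in $(q_I,0)$, and $\mathcal L(\mathcal A)$ is the set of timed words with a run ending in a state of $F$. $\mathcal A$ is deterministic (a 1-DTA) if distinct transitions with the same source and the same letter have guards defining disjoint sets, and complete if moreover every timed word has exactly one run. Its (maximum) constant is the largest constant occurring in its guards ($0$ if there is none). For $K\in\mathbb N$, the $K$-regions are the sets $\{c\}$ ($0\le c\le K$),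 $(c,c+1)$ ($0\le c<K$) and $(K,\infty)$. A complete 1-DTA $\mathcal A$ induces the reset function $R^{\mathcal A}$ that maps each timed word $u$ to the clock value after reading $u$. A timed language is 1-DTA recognizable if it is $\mathcal L(\mathcal A)$ for some 1-DTA $\mathcal A$. For a timed language $L$ put $u^{-1}L=\{w\mid uw\in L\}$, and define its syntactic reset function $\mathbf R^L$ inductively by $\mathbf R^L(\varepsilon)=0$ and $$\mathbf R^L(u(t\cdot a))=\begin{cases}0&\text{if }(u(t\cdot a))^{-1}L\text{ is 1-DTA recognizable},\\ \mathbf R^L(u)+t&\text{otherwise.}\end{cases}$$ Theorem. Let $\Sigma$ be a finite alphabet. 1. There is a computable function that maps every 1-DTA $\mathcal A$ over $\Sigma$, with language $L$ and maximum constant $K$, to a complete 1-DTA $\mathcal B$ over $\Sigma$ with $\mathcal L(\mathcal B)=L$, with the same maximum constant $K$, all of whose guards define $K$-regions, and which induces the syntactic reset function: $R^{\mathcal B}=\mathbf R^L$. 2. If $L$ is a 1-DTA recognizable timed language over $\Sigma$, then $\mathbf R^L(u)\in[0,K_L]\setminus\mathbb N_{>0}$ for every timed word $u$, where $K_L$ is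 the smallest $K\in\mathbb N$ such that some 1-DTA with maximum constant $K$ accepts $L$. -/

import Mathlib

open scoped NNReal

namespace OneClock

universe u

/-- Timed words over `α`: finite sequences of pairs (delay, letter). -/
abbrev TimedWord (α : Type u) := List (ℝ≥0 × α)

/-- Residual language `u⁻¹L`. -/
def residual {α : Type u} (L : Set (TimedWord α)) (u : TimedWord α) : Set (TimedWord α) :=
  {w | u ++ w ∈ L}

/-- Atomic clock constraints: `c < x`, `x = c`, `x < c` with `c` a natural number. -/
inductive Atom where
  | gt (c : ℕ)
  | eq (c : ℕ)
  | lt (c : ℕ)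

/-- The constant occurring in an atomic constraint. -/
def Atom.const : Atom → ℕ
  | .gt c => c
  | .eq c => c
  | .lt c => c

/-- The clock values that satisfy an atomic constraint. -/
def Atom.denote : Atom → Set ℝ≥0
  | .gt c => {x | (c : ℝ≥0) < x}
  | .eq c => {x | x = (c : ℝ≥0)}
  | .lt c => {x | x < (c : ℝ≥0)}

/-- A clock constraint is a conjunction of one or more atomic constraints
(the first one, and the list of the others). -/
abbrev Guard := Atom × List Atom

/-- All atomic constraints of a clock constraint. -/
def Guard.atoms (g : Guard) : List Atom := g.1 :: g.2

/-- The set of clock values that satisfy a clock constraint. -/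
def Guard.denote (g : Guard) : Set ℝ≥0 := {x | ∀ c ∈ Guard.atoms g, x ∈ c.denote}

/-- A transition from `src` to `tgt`; the clock is reset iff `reset = true`. -/
structure Transition (α : Type u) where
  src : ℕ
  tgt : ℕ
  letter : α
  guard : Guard
  reset : Bool

/-- The clock value after taking the transition with clock value `x`. -/
def Transition.update {α : Type u} (θ : Transition α) (x : ℝ≥0) : ℝ≥0 :=
  if θ.reset = true then 0 else x

/-- A one-clock timed automaton over `α`, as a finite object that algorithms can manipulate.
States are natural numbers; the (finite) state set consists of the states that occur in the
automaton. The lists `trans` and `final` enumerate the finite sets of transitions and of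
final states. -/
structure OneTA (α : Type u) where
  init : ℕ
  trans : List (Transition α)
  final : List ℕ

namespace OneTA

variable {α : Type u}

/-- `A.Run q ν w q' ν'`: there is a run of `A` on `w` from configuration `(q, ν)` to
configuration `(q', ν')`. -/
inductive Run (A : OneTA α) : ℕ → ℝ≥0 → TimedWord α → ℕ → ℝ≥0 → Prop
  | nil (q : ℕ) (ν : ℝ≥0) : Run A q ν [] q ν
  | cons (θ : Transition α) (q : ℕ) (ν t : ℝ≥0) (a : α) (w : TimedWord α) (q' : ℕ) (ν' : ℝ≥0)
      (mem : θ ∈ A.trans) (hsrc : θ.src = q) (hletter : θ.letter = a)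
      (sat : ν + t ∈ Guard.denote θ.guard)
      (rest : Run A θ.tgt (θ.update (ν + t)) w q' ν') :
      Run A q ν ((t, a) :: w) q' ν'

/-- The language of `A`: the timed words with an accepting run from the initial
configuration. -/
def lang (A : OneTA α) : Set (TimedWord α) :=
  {w | ∃ q ∈ A.final, ∃ ν : ℝ≥0, A.Run A.init 0 w q ν}

/-- Determinism: distinct transitions with the same source and the same letter have disjoint
guards. -/
def Deterministic (A : OneTA α) : Prop :=
  ∀ θ ∈ A.trans, ∀ θ' ∈ A.trans, θ ≠ θ' →
    θ.src ≠ θ'.src ∨ θ.letter ≠ θ'.letter ∨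
      Guard.denote θ.guard ∩ Guard.denote θ'.guard = ∅

/-- Every timed word has a run from the initial configuration (for a deterministic automaton
it then has exactly one). -/
def Complete (A : OneTA α) : Prop :=
  ∀ w : TimedWord α, ∃ (q : ℕ) (ν : ℝ≥0), A.Run A.init 0 w q ν

/-- All constants that occur in the guards of `A`. -/
def constants (A : OneTA α) : List ℕ :=
  A.trans.flatMap fun θ => (Guard.atoms θ.guard).map Atom.const

/-- The maximum constant of `A` (`0` if there are no transitions). -/
def maxConst (A : OneTA α) : ℕ := A.constants.foldr max 0

/-- `A` (deterministic and complete) induces the reset function `R`: after reading `u`, the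
clock of `A` has the value `R u`. -/
def Induces (A : OneTA α) (R : TimedWord α → ℝ≥0) : Prop :=
  ∀ u : TimedWord α, ∃ q : ℕ, A.Run A.init 0 u q (R u)

end OneTA

/-- The `K`-regions: `{c}` with `c ≤ K`, `(c, c + 1)` with `c < K`, and `(K, ∞)`. -/
def IsRegion (K : ℕ) (S : Set ℝ≥0) : Prop :=
  (∃ c : ℕ, c ≤ K ∧ S = {(c : ℝ≥0)}) ∨
  (∃ c : ℕ, c < K ∧ S = Set.Ioo (c : ℝ≥0) ((c : ℝ≥0) + 1)) ∨
  S = Set.Ioi (K : ℝ≥0)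

/-- Every guard of `A` defines a `K`-region, for `K` the maximum constant of `A`. -/
def OneTA.RegionGuarded {α : Type u} (A : OneTA α) : Prop :=
  ∀ θ ∈ A.trans, IsRegion A.maxConst (Guard.denote θ.guard)

/-- `L` is recognized by a one-clock deterministic timed automaton. -/
def Recognizable {α : Type u} (L : Set (TimedWord α)) : Prop :=
  ∃ A : OneTA α, A.Deterministic ∧ A.lang = L

/-- The smallest `K` such that some one-clock deterministic timed automaton with maximum
constant `K` accepts `L` (used only for recognizable `L`). -/
noncomputable def minConst {α : Type u} (L : Set (TimedWord α)) : ℕ :=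
  sInf {K : ℕ | ∃ A : OneTA α, A.Deterministic ∧ A.lang = L ∧ A.maxConst = K}

open Classical in
/-- Auxiliary recursion for the syntactic reset function: `y` is the current clock value and
`L` the current residual language. -/
noncomputable def synResetFrom {α : Type u} :
    Set (TimedWord α) → ℝ≥0 → TimedWord α → ℝ≥0
  | _, y, [] => y
  | L, y, p :: w =>
      synResetFrom (residual L [p]) (if Recognizable (residual L [p]) then 0 else y + p.1) w

/-- The syntactic reset function of `L`. -/
noncomputable def synReset {α : Type u} (L : Set (TimedWord α)) (u : TimedWord α) : ℝ≥0 :=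
  synResetFrom L 0 u

theorem synReset_nil {α : Type u} (L : Set (TimedWord α)) : synReset L [] = 0 := rfl

open Classical in
theorem synResetFrom_snoc {α : Type u} (u : TimedWord α) (t : ℝ≥0) (a : α) :
    ∀ (L : Set (TimedWord α)) (y : ℝ≥0), synResetFrom L y (u ++ [(t, a)]) =
      if Recognizable (residual L (u ++ [(t, a)])) then 0 else synResetFrom L y u + t := by
  induction u with
  | nil => intro L y; rfl
  | cons p u ih =>
    intro L y
    simp only [List.cons_append, synResetFrom]
    rw [ih]
    rfl

open Classical in
/-- The defining recursion of the syntactic reset function. -/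
theorem synReset_snoc {α : Type u} (L : Set (TimedWord α)) (u : TimedWord α) (t : ℝ≥0) (a : α) :
    synReset L (u ++ [(t, a)]) =
      if Recognizable (residual L (u ++ [(t, a)])) then 0 else synReset L u + t :=
  synResetFrom_snoc u t a L 0

/-! Codings of the finite objects above, so that computability of functions on automata makes
sense. -/

def Atom.equivSum : Atom ≃ ℕ ⊕ ℕ ⊕ ℕ where
  toFun
    | .gt c => Sum.inl c
    | .eq c => Sum.inr (Sum.inl c)
    | .lt c => Sum.inr (Sum.inr c)
  invFun
    | Sum.inl c => .gt c
    | Sum.inr (Sum.inl c) => .eq c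
    | Sum.inr (Sum.inr c) => .lt c
  left_inv a := by cases a <;> rfl
  right_inv s := by rcases s with c | c | c <;> rfl

instance : Primcodable Atom := Primcodable.ofEquiv _ Atom.equivSum

def Transition.equivProd (α : Type u) : Transition α ≃ ℕ × ℕ × α × Guard × Bool where
  toFun θ := (θ.src, θ.tgt, θ.letter, θ.guard, θ.reset)
  invFun p := ⟨p.1, p.2.1, p.2.2.1, p.2.2.2.1, p.2.2.2.2⟩
  left_inv _ := rfl
  right_inv _ := rfl

instance {α : Type u} [Primcodable α] : Primcodable (Transition α) :=
  Primcodable.ofEquiv _ (Transition.equivProd α)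

def OneTA.equivProd (α : Type u) : OneTA α ≃ ℕ × List (Transition α) × List ℕ where
  toFun A := (A.init, A.trans, A.final)
  invFun p := ⟨p.1, p.2.1, p.2.2⟩
  left_inv _ := rfl
  right_inv _ := rfl

instance {α : Type u} [Primcodable α] : Primcodable (OneTA α) :=
  Primcodable.ofEquiv _ (OneTA.equivProd α)

end OneClock

/-! Whether two configurations accept the same language depends only on their states, on the regions
of their clock values x and x', and on the position of x - x' relative to the integers
(`forall_accepts_eq_of_sameRegion`). This has two consequences. All pairs x < x' inside an open unit
interval are placed alike, so the languages accepted from a state with clock values in that interval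
are either all equal or pairwise distinct (`accepts_congr_of_accepts_eq`). And if one of these
languages is accepted by some automaton from clock value 0, the comparison of x with 0 makes them
all equal (`accepts_congr_of_accepts_zero_eq`). So a language that varies with the clock value
inside an open interval is not recognizable (`not_recognizable_langFrom`).

In all other cases the clock can be reset, because it suffices to remember the region of the clock
of A at the reset. This is what `canon` does. If the remembered region is {c}, the clock of A equals
c plus the current clock. If it is open, any of its values represents the language, and values close
to the infimum are followed. Two such values are driven by the next delay into a common region,
where equal residuals force constancy, so the clock is reset again. A positive clock value thus only
arises over an integer c, inside an open unit interval below the maximum constant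
(`Represents.exists_transition`). This invariant yields the syntactic reset function
(`Represents.exists_run_synResetFrom`) and its range, the latter from an automaton with the least
constant.

Computability rests on deciding constancy on an interval (`constOn_iff`). Agreement on words of
bounded length stabilises at a computable length (`Agree.forall_accepts_eq`), and delays can be
bounded and moved to a finite grid, which leaves finitely many words to test. -/

namespace OneClock

/-! ### Regions of a single clock value -/

/-- Index of the region of a clock value: `2 * c` for the value `c`, and `2 * c + 1` for the
values in the open interval `(c, c + 1)`. -/
noncomputable def reg (x : ℝ≥0) : ℕ := ⌊x⌋₊ + ⌈x⌉₊

theorem two_mul_lt_reg {c : ℕ} {x : ℝ≥0} : 2 * c < reg x ↔ (c : ℝ≥0) < x := by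
  have h1 := Nat.floor_le_ceil x
  have h2 := Nat.ceil_le_floor_add_one x
  rw [← Nat.lt_ceil, reg]
  omega

theorem reg_lt_two_mul {c : ℕ} {x : ℝ≥0} : reg x < 2 * c ↔ x < (c : ℝ≥0) := by
  have h1 := Nat.floor_le_ceil x
  have h2 := Nat.ceil_le_floor_add_one x
  rw [← Nat.floor_lt zero_le, reg]
  omega

theorem reg_eq_two_mul {c : ℕ} {x : ℝ≥0} : reg x = 2 * c ↔ x = (c : ℝ≥0) := by
  rw [eq_iff_le_not_lt, eq_iff_le_not_lt, ← not_lt, ← not_lt, two_mul_lt_reg, reg_lt_two_mul]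

theorem reg_eq_two_mul_add_one {c : ℕ} {x : ℝ≥0} :
    reg x = 2 * c + 1 ↔ (c : ℝ≥0) < x ∧ x < (c : ℝ≥0) + 1 := by
  have h : (c : ℝ≥0) + 1 = ((c + 1 : ℕ) : ℝ≥0) := by push_cast; rfl
  rw [h, ← two_mul_lt_reg, ← reg_lt_two_mul]
  omega

@[simp] theorem reg_natCast (c : ℕ) : reg (c : ℝ≥0) = 2 * c := reg_eq_two_mul.2 rfl

theorem reg_natCast_add (c : ℕ) (x : ℝ≥0) : reg ((c : ℝ≥0) + x) = 2 * c + reg x := by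
  have h1 : ⌊(c : ℝ≥0) + x⌋₊ = c + ⌊x⌋₊ := by
    rw [add_comm, Nat.floor_add_natCast zero_le, add_comm]
  have h2 : ⌈(c : ℝ≥0) + x⌉₊ = c + ⌈x⌉₊ := by
    rw [add_comm, Nat.ceil_add_natCast zero_le, add_comm]
  rw [reg, reg, h1, h2]
  ring

/-- Truth of an atomic constraint in the region with index `r`. -/
def Atom.sat : Atom → ℕ → Bool
  | .gt c, r => decide (2 * c < r)
  | .eq c, r => decide (r = 2 * c)
  | .lt c, r => decide (r < 2 * c)

theorem Atom.mem_denote_iff (c : Atom) (x : ℝ≥0) : x ∈ c.denote ↔ c.sat (reg x) = true := by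
  cases c <;> simp [Atom.denote, Atom.sat, two_mul_lt_reg, reg_lt_two_mul, reg_eq_two_mul]

/-- Indices from 2K + 1 on belong to values above K, which constants up to K cannot separate. The
index 2K + 1 can therefore stand for the whole region (K, ∞). -/
theorem Atom.sat_min {c : Atom} {K : ℕ} (h : c.const ≤ K) (r : ℕ) :
    c.sat (min r (2 * K + 1)) = c.sat r := by
  cases c <;> simp only [Atom.sat, Atom.const] at h ⊢ <;> congr 1 <;> apply propext <;> omega

/-- Truth of a clock constraint in the region with index `r`. -/
def Guard.sat (g : Guard) (r : ℕ) : Bool := (Guard.atoms g).all fun c => c.sat r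

theorem Guard.mem_denote_iff (g : Guard) (x : ℝ≥0) :
    x ∈ Guard.denote g ↔ Guard.sat g (reg x) = true := by
  simp [Guard.denote, Guard.sat, Atom.mem_denote_iff]

theorem le_foldr_max {l : List ℕ} {n : ℕ} (h : n ∈ l) : n ≤ l.foldr max 0 := by
  induction l with
  | nil => simp at h
  | cons a l ih =>
    rcases List.mem_cons.1 h with rfl | h
    · exact le_max_left _ _
    · exact (ih h).trans (le_max_right _ _)

/-! ### Runs of a deterministic automaton as a total step function with a sink -/

namespace OneTA

variable {α : Type*}

theorem const_le_maxConst {A : OneTA α} {θ : Transition α} (hθ : θ ∈ A.trans) {c : Atom}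
    (hc : c ∈ Guard.atoms θ.guard) : c.const ≤ A.maxConst :=
  le_foldr_max (List.mem_flatMap.2 ⟨θ, hθ, List.mem_map.2 ⟨c, hc, rfl⟩⟩)

theorem sat_min_maxConst {A : OneTA α} {θ : Transition α} (hθ : θ ∈ A.trans) (r : ℕ) :
    Guard.sat θ.guard (min r (2 * A.maxConst + 1)) = Guard.sat θ.guard r := by
  rw [Bool.eq_iff_iff]
  simp only [Guard.sat, List.all_eq_true]
  exact forall₂_congr fun c hc => by rw [Atom.sat_min (const_le_maxConst hθ hc)]

theorem Deterministic.eq_of_sat {A : OneTA α} (hA : A.Deterministic) {θ θ' : Transition α}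
    (h : θ ∈ A.trans) (h' : θ' ∈ A.trans) (hsrc : θ.src = θ'.src) (hl : θ.letter = θ'.letter)
    {x : ℝ≥0} (hx : x ∈ Guard.denote θ.guard) (hx' : x ∈ Guard.denote θ'.guard) : θ = θ' := by
  by_contra hne
  rcases hA θ h θ' h' hne with h | h | h
  · exact h hsrc
  · exact h hl
  · exact (h ▸ (⟨hx, hx'⟩ : x ∈ Guard.denote θ.guard ∩ Guard.denote θ'.guard) :
      x ∈ (∅ : Set ℝ≥0))

theorem Deterministic.run_unique {A : OneTA α} (hA : A.Deterministic) {q q₁ q₂ : ℕ}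
    {x x₁ x₂ : ℝ≥0} {w : TimedWord α} (h₁ : A.Run q x w q₁ x₁) (h₂ : A.Run q x w q₂ x₂) :
    q₁ = q₂ ∧ x₁ = x₂ := by
  induction h₁ with
  | nil => cases h₂; exact ⟨rfl, rfl⟩
  | cons θ q ν t a w _ _ mem hsrc hletter sat _ ih =>
    cases h₂ with
    | cons θ' _ _ _ _ _ _ _ mem' hsrc' hletter' sat' hrest =>
      obtain rfl := hA.eq_of_sat mem mem' (hsrc.trans hsrc'.symm) (hletter.trans hletter'.symm)
        sat sat'
      exact ih hrest

/-- Acceptance by the empty word, with the states shifted by one to make room for a sink state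
`0`. -/
def accepting (A : OneTA α) (q : ℕ) : Bool := decide (q ∈ A.final.map Nat.succ)

@[simp] theorem accepting_sink (A : OneTA α) : A.accepting 0 = false := by
  simp [accepting]

variable [DecidableEq α]

/-- The first transition of `A` with letter `a` that is enabled in region `r` of state `q`. The
states of `A` are shifted by one. -/
def enabled (A : OneTA α) (q : ℕ) (a : α) (r : ℕ) : Option (Transition α) :=
  (A.trans.filter fun θ => (θ.src + 1 = q ∧ θ.letter = a) ∧ Guard.sat θ.guard r = true).head?

/-- Target and reset of the step of `A`, completed by the sink state `0`. -/
def step (A : OneTA α) (q : ℕ) (a : α) (r : ℕ) : ℕ × Bool :=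
  ((A.enabled q a r).map fun θ => (θ.tgt + 1, θ.reset)).getD (0, true)

/-- Acceptance of a timed word from state `q` with clock value `x`. -/
noncomputable def accepts (A : OneTA α) : ℕ → ℝ≥0 → TimedWord α → Bool
  | q, _, [] => A.accepting q
  | q, x, (t, a) :: w =>
      A.accepts (A.step q a (reg (x + t))).1
        (if (A.step q a (reg (x + t))).2 = true then 0 else x + t) w

theorem step_min (A : OneTA α) (q : ℕ) (a : α) (r : ℕ) :
    A.step q a (min r (2 * A.maxConst + 1)) = A.step q a r := by
  have : A.enabled q a (min r (2 * A.maxConst + 1)) = A.enabled q a r := by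
    unfold enabled
    congr 1
    apply List.filter_congr
    intro θ hθ
    rw [sat_min_maxConst hθ]
  rw [step, this, step]

/-- By determinism the list of enabled transitions contains nothing but copies of θ, so its head is
θ. -/
theorem step_eq_of_mem {A : OneTA α} (hA : A.Deterministic) {θ : Transition α}
    (hθ : θ ∈ A.trans) {x : ℝ≥0} (hx : x ∈ Guard.denote θ.guard) :
    A.step (θ.src + 1) θ.letter (reg x) = (θ.tgt + 1, θ.reset) := by
  have hmem : θ ∈ A.trans.filter fun θ' => (θ'.src + 1 = θ.src + 1 ∧ θ'.letter = θ.letter) ∧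
      Guard.sat θ'.guard (reg x) = true := by
    simp [hθ, (Guard.mem_denote_iff _ _).1 hx]
  have : A.enabled (θ.src + 1) θ.letter (reg x) = some θ := by
    unfold enabled
    cases hl : A.trans.filter fun θ' => (θ'.src + 1 = θ.src + 1 ∧ θ'.letter = θ.letter) ∧
      Guard.sat θ'.guard (reg x) = true with
    | nil => rw [hl] at hmem; simp at hmem
    | cons θ' l =>
      have h' : θ' ∈ A.trans.filter fun θ' => (θ'.src + 1 = θ.src + 1 ∧ θ'.letter = θ.letter) ∧
          Guard.sat θ'.guard (reg x) = true := by rw [hl]; exact List.mem_cons_self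
      simp only [List.mem_filter, decide_eq_true_eq, Nat.add_right_cancel_iff] at h'
      rw [List.head?_cons, hA.eq_of_sat h'.1 hθ h'.2.1.1 h'.2.1.2
        ((Guard.mem_denote_iff _ _).2 h'.2.2) hx]
  rw [step, this]
  rfl

theorem step_cases (A : OneTA α) (q : ℕ) (a : α) (x : ℝ≥0) :
    (∃ θ ∈ A.trans, θ.src + 1 = q ∧ θ.letter = a ∧ x ∈ Guard.denote θ.guard ∧
      A.step q a (reg x) = (θ.tgt + 1, θ.reset)) ∨ A.step q a (reg x) = (0, true) := by
  cases h : A.enabled q a (reg x) with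
  | none => right; rw [step, h]; rfl
  | some θ =>
    left
    have hm := List.mem_of_mem_head? (Option.mem_def.2 h)
    simp only [List.mem_filter, decide_eq_true_eq] at hm
    exact ⟨θ, hm.1, hm.2.1.1, hm.2.1.2, (Guard.mem_denote_iff _ _).2 hm.2.2, by rw [step, h]; rfl⟩

@[simp] theorem step_sink (A : OneTA α) (a : α) (r : ℕ) : A.step 0 a r = (0, true) := by
  simp [step, enabled]

@[simp] theorem accepts_sink (A : OneTA α) (x : ℝ≥0) (w : TimedWord α) :
    A.accepts 0 x w = false := by
  induction w generalizing x with
  | nil => simp [accepts]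
  | cons p w ih => obtain ⟨t, a⟩ := p; simp [accepts, ih]

theorem Deterministic.accepts_iff {A : OneTA α} (hA : A.Deterministic) (q : ℕ) (x : ℝ≥0)
    (w : TimedWord α) :
    A.accepts (q + 1) x w = true ↔ ∃ q' ∈ A.final, ∃ x' : ℝ≥0, A.Run q x w q' x' := by
  induction w generalizing q x with
  | nil =>
    simp only [accepts, accepting, List.mem_map, Nat.succ_eq_add_one, Nat.add_right_cancel_iff,
      exists_eq_right, decide_eq_true_eq]
    constructor
    · intro h
      exact ⟨q, h, x, .nil q x⟩
    · rintro ⟨q', h, x', hr⟩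
      cases hr
      exact h
  | cons p w ih =>
    obtain ⟨t, a⟩ := p
    constructor
    · intro h
      rw [accepts] at h
      rcases A.step_cases (q + 1) a (x + t) with ⟨θ, hθ, hsrc, hl, hx, hs⟩ | hs
      · rw [hs] at h
        obtain ⟨q', hq', x', hr⟩ := (ih _ _).1 h
        exact ⟨q', hq', x', .cons θ _ _ _ _ _ _ _ hθ (Nat.succ.inj hsrc) hl hx hr⟩
      · rw [hs] at h
        simp at h
    · rintro ⟨q', hq', x', hr⟩
      cases hr with
      | cons θ _ _ _ _ _ _ _ mem hsrc hletter sat rest =>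
        subst hsrc hletter
        rw [accepts, step_eq_of_mem hA mem sat]
        exact (ih _ _).2 ⟨q', hq', x', rest⟩

theorem Deterministic.mem_lang_iff {A : OneTA α} (hA : A.Deterministic) (w : TimedWord α) :
    w ∈ A.lang ↔ A.accepts (A.init + 1) 0 w = true := by
  rw [hA.accepts_iff]
  rfl

theorem step_congr_of_lt {A : OneTA α} {x x' : ℝ≥0} (hx : (A.maxConst : ℝ≥0) < x)
    (hx' : (A.maxConst : ℝ≥0) < x') (q : ℕ) (a : α) :
    A.step q a (reg x) = A.step q a (reg x') := by
  rw [← step_min A q a (reg x), ← step_min A q a (reg x'),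
    min_eq_right (a := reg x') (two_mul_lt_reg.2 hx'), min_eq_right (two_mul_lt_reg.2 hx)]

/-- Acceptance does not depend on clock values above the maximum constant. -/
theorem accepts_congr_of_lt {A : OneTA α} {x x' : ℝ≥0} (hx : (A.maxConst : ℝ≥0) < x)
    (hx' : (A.maxConst : ℝ≥0) < x') (q : ℕ) (w : TimedWord α) :
    A.accepts q x w = A.accepts q x' w := by
  induction w generalizing q x x' with
  | nil => rfl
  | cons p w ih =>
    obtain ⟨t, a⟩ := p
    have h1 : (A.maxConst : ℝ≥0) < x + t := hx.trans_le le_self_add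
    have h2 : (A.maxConst : ℝ≥0) < x' + t := hx'.trans_le le_self_add
    rw [accepts, accepts, step_congr_of_lt h1 h2]
    split
    · rfl
    · exact ih h1 h2 _

end OneTA

/-! ### Regions of pairs of clock values -/

/-- Position of a real number relative to the integers. -/
noncomputable def ireg (z : ℝ) : ℤ := ⌊z⌋ + ⌈z⌉

/-- Ceiling and floor differ by 0 or 1, so the parity of their sum gives the difference and the sum
gives both. -/
theorem floor_eq_of_ireg_eq {z z' : ℝ} (h : ireg z = ireg z') : ⌊z⌋ = ⌊z'⌋ ∧ ⌈z⌉ = ⌈z'⌉ := by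
  have h1 := Int.floor_le_ceil z
  have h2 := Int.ceil_le_floor_add_one z
  have h3 := Int.floor_le_ceil z'
  have h4 := Int.ceil_le_floor_add_one z'
  unfold ireg at h
  omega

theorem lt_intCast_iff_of_ireg_eq {z z' : ℝ} (h : ireg z = ireg z') (n : ℤ) :
    z < n ↔ z' < n := by
  rw [← Int.floor_lt, ← Int.floor_lt, (floor_eq_of_ireg_eq h).1]

theorem le_intCast_iff_of_ireg_eq {z z' : ℝ} (h : ireg z = ireg z') (n : ℤ) :
    z ≤ n ↔ z' ≤ n := by
  rw [← Int.ceil_le, ← Int.ceil_le, (floor_eq_of_ireg_eq h).2]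

theorem ireg_add_intCast (z : ℝ) (n : ℤ) : ireg (z + n) = ireg z + 2 * n := by
  rw [ireg, ireg, Int.floor_add_intCast, Int.ceil_add_intCast]
  ring

theorem ireg_neg (z : ℝ) : ireg (-z) = -ireg z := by
  rw [ireg, ireg, Int.floor_neg, Int.ceil_neg]
  ring

theorem ireg_eq_of_mem_Ioo {z : ℝ} {n : ℤ} (h1 : (n : ℝ) < z) (h2 : z < n + 1) :
    ireg z = 2 * n + 1 := by
  have hf : ⌊z⌋ = n := Int.floor_eq_iff.2 ⟨h1.le, h2⟩
  have hc : ⌈z⌉ = n + 1 := Int.ceil_eq_iff.2 ⟨by push_cast; linarith, by push_cast; linarith⟩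
  rw [ireg, hf, hc]
  ring

theorem natCast_reg (x : ℝ≥0) : (reg x : ℤ) = ireg (x : ℝ) := by
  have h1 : ⌊(x : ℝ)⌋₊ = ⌊x⌋₊ := rfl
  have h2 : ⌈(x : ℝ)⌉₊ = ⌈x⌉₊ := rfl
  rw [reg, ireg, Nat.cast_add, ← h1, ← h2, Int.natCast_floor_eq_floor x.coe_nonneg,
    Int.natCast_ceil_eq_ceil x.coe_nonneg]

theorem reg_eq_reg_iff {x y : ℝ≥0} : reg x = reg y ↔ ireg (x : ℝ) = ireg (y : ℝ) := by
  rw [← natCast_reg, ← natCast_reg, Nat.cast_inj]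

theorem le_natCast_iff_of_reg_eq {x y : ℝ≥0} (h : reg x = reg y) (n : ℕ) :
    x ≤ n ↔ y ≤ n := by
  rw [← not_lt, ← not_lt, ← two_mul_lt_reg, ← two_mul_lt_reg, h]

/-- Extension property of the order of the reals with the translation by one: a finite tuple `q`
that is placed like `p` can be extended when `p` is, and the new point lies on a grid at most twice
as fine. -/
theorem exists_ireg_sub_eq {ι : Type*} [Finite ι] [Nonempty ι] {p q : ι → ℝ}
    (h : ∀ i j, ireg (p i - p j) = ireg (q i - q j)) (z : ℝ) :
    ∃ z' : ℝ, (∀ i, ireg (z - p i) = ireg (z' - q i)) ∧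
      ∀ D : ℕ, (∀ i, ∃ n : ℤ, (D : ℝ) * q i = n) → ∃ n : ℤ, ((2 * D : ℕ) : ℝ) * z' = n := by
  by_cases hz : ∃ i, ∃ m : ℤ, z = p i + m
  · obtain ⟨i, m, rfl⟩ := hz
    refine ⟨q i + m, fun j => ?_, fun D hD => ?_⟩
    · rw [show p i + m - p j = p i - p j + m by ring, show q i + m - q j = q i - q j + m by ring,
        ireg_add_intCast, ireg_add_intCast, h]
    · obtain ⟨n, hn⟩ := hD i
      refine ⟨2 * n + 2 * D * m, ?_⟩
      push_cast
      rw [← hn]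
      ring
  · have key : ∀ i, ((⌊z - p i⌋ : ℤ) : ℝ) < z - p i := fun i =>
      lt_of_le_of_ne (Int.floor_le _) fun he => hz ⟨i, ⌊z - p i⌋, by rw [he]; ring⟩
    -- The new point has to lie in finitely many open unit intervals, one for each index. The
    -- largest left end lies below the smallest right end because the same holds for `p`. Their
    -- midpoint is taken, whence the factor 2 in the grid.
    obtain ⟨i, hi⟩ := Finite.exists_max fun i => q i + ⌊z - p i⌋
    obtain ⟨j, hj⟩ := Finite.exists_min fun i => q i + ⌊z - p i⌋ + 1
    have hlt : q i + ⌊z - p i⌋ < q j + ⌊z - p j⌋ + 1 := by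
      have h1 : p i - p j < ((⌊z - p j⌋ + 1 - ⌊z - p i⌋ : ℤ) : ℝ) := by
        have := key i
        have := Int.lt_floor_add_one (z - p j)
        push_cast
        linarith
      have h2 := (lt_intCast_iff_of_ireg_eq (h i j) _).1 h1
      push_cast at h2
      linarith
    refine ⟨(q i + ⌊z - p i⌋ + (q j + ⌊z - p j⌋ + 1)) / 2, fun k => ?_, fun D hD => ?_⟩
    · rw [ireg_eq_of_mem_Ioo (key k) (Int.lt_floor_add_one _), eq_comm]
      have h1 := hi k
      have h2 := hj k
      exact ireg_eq_of_mem_Ioo (by linarith) (by linarith)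
    · obtain ⟨m, hm⟩ := hD i
      obtain ⟨n, hn⟩ := hD j
      refine ⟨m + D * ⌊z - p i⌋ + (n + D * ⌊z - p j⌋ + D), ?_⟩
      push_cast
      rw [← hm, ← hn]
      ring

/-- Multiples of `1 / D`. -/
def OnGrid (D : ℕ) (x : ℝ≥0) : Prop := ∃ n : ℕ, (D : ℝ≥0) * x = n

theorem OnGrid.zero (D : ℕ) : OnGrid D 0 := ⟨0, by simp⟩

theorem OnGrid.mono {D D' : ℕ} (h : D ∣ D') {x : ℝ≥0} (hx : OnGrid D x) : OnGrid D' x := by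
  obtain ⟨k, rfl⟩ := h
  obtain ⟨n, hn⟩ := hx
  refine ⟨k * n, ?_⟩
  push_cast
  rw [← hn]
  ring

theorem OnGrid.add {D : ℕ} {x y : ℝ≥0} (hx : OnGrid D x) (hy : OnGrid D y) :
    OnGrid D (x + y) := by
  obtain ⟨m, hm⟩ := hx
  obtain ⟨n, hn⟩ := hy
  exact ⟨m + n, by rw [mul_add, hm, hn, Nat.cast_add]⟩

/-- Equality of the regions of two pairs of clock values. -/
structure SameRegion (x x' y y' : ℝ≥0) : Prop where
  left : reg x = reg y
  right : reg x' = reg y'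
  sub : ireg ((x : ℝ) - x') = ireg ((y : ℝ) - y')

namespace SameRegion

variable {x x' y y' : ℝ≥0}

theorem swap (h : SameRegion x x' y y') : SameRegion x' x y' y :=
  ⟨h.right, h.left, by rw [← neg_sub, ireg_neg, h.sub, ← ireg_neg, neg_sub]⟩

theorem reset_right (h : SameRegion x x' y y') : SameRegion x 0 y 0 :=
  ⟨h.left, rfl, by simpa using reg_eq_reg_iff.1 h.left⟩

theorem reset_left (h : SameRegion x x' y y') : SameRegion 0 x' 0 y' := h.swap.reset_right.swap

/-- The time-successor property of two-clock regions. Keeping the region of the delay itself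
preserves integer bounds on delays. -/
theorem exists_delay (h : SameRegion x x' y y') (t : ℝ≥0) :
    ∃ t' : ℝ≥0, reg t = reg t' ∧ SameRegion (x + t) (x' + t) (y + t') (y' + t') ∧
      ∀ D, OnGrid D y → OnGrid D y' → OnGrid (2 * D) t' := by
  have hl := reg_eq_reg_iff.1 h.left
  have hr := reg_eq_reg_iff.1 h.right
  have hall : ∀ i j, ireg ((![0, (x : ℝ), x'] : Fin 3 → ℝ) i - ![0, (x : ℝ), x'] j) =
      ireg ((![0, (y : ℝ), y'] : Fin 3 → ℝ) i - ![0, (y : ℝ), y'] j) := by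
    intro i j
    fin_cases i <;> fin_cases j <;> simp [ireg_neg, hl, hr, h.sub, h.swap.sub]
  -- A delay is a new point -t next to 0, x and x': its differences to them are the negatives of t,
  -- x + t and x' + t.
  obtain ⟨z, hz, hD⟩ := exists_ireg_sub_eq hall (-(t : ℝ))
  have h0 : ireg (-(t : ℝ)) = ireg z := by simpa using hz 0
  have h1 : ireg (-(t : ℝ) - x) = ireg (z - y) := by simpa using hz 1
  have h2 : ireg (-(t : ℝ) - x') = ireg (z - y') := by simpa using hz 2
  have hz0 : z ≤ 0 := by
    have := (le_intCast_iff_of_ireg_eq h0 0).1 (by simp)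
    simpa using this
  obtain ⟨s, hs⟩ : ∃ s : ℝ≥0, (s : ℝ) = -z := ⟨⟨-z, by linarith⟩, rfl⟩
  refine ⟨s, ?_, ⟨?_, ?_, ?_⟩, fun D hy hy' => ?_⟩
  · rw [reg_eq_reg_iff, hs, ireg_neg, ← h0, ireg_neg, neg_neg]
  · rw [reg_eq_reg_iff, NNReal.coe_add, NNReal.coe_add, hs,
      show (y : ℝ) + -z = -(z - y) by ring, ireg_neg, ← h1, ← ireg_neg]
    congr 1
    ring
  · rw [reg_eq_reg_iff, NNReal.coe_add, NNReal.coe_add, hs,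
      show (y' : ℝ) + -z = -(z - y') by ring, ireg_neg, ← h2, ← ireg_neg]
    congr 1
    ring
  · simpa using h.sub
  · obtain ⟨m, hm⟩ := hy
    obtain ⟨m', hm'⟩ := hy'
    obtain ⟨n, hn⟩ := hD D (by
      intro i
      fin_cases i
      · exact ⟨0, by simp⟩
      · exact ⟨m, by simpa using congrArg NNReal.toReal hm⟩
      · exact ⟨m', by simpa using congrArg NNReal.toReal hm'⟩)
    have hn0 : n ≤ 0 := by
      have : (n : ℝ) ≤ 0 := by rw [← hn]; exact mul_nonpos_of_nonneg_of_nonpos (by positivity) hz0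
      exact_mod_cast this
    obtain ⟨k, hk⟩ := Int.exists_eq_neg_ofNat hn0
    refine ⟨k, ?_⟩
    rw [← NNReal.coe_inj, NNReal.coe_mul, hs, mul_neg]
    push_cast at hn ⊢
    rw [hn, hk]
    simp

end SameRegion

/-- Every pair of clock values has the region of a pair of multiples of `1 / 4`. -/
theorem exists_sameRegion_onGrid (x x' : ℝ≥0) :
    ∃ y y', SameRegion x x' y y' ∧ OnGrid 4 y ∧ OnGrid 4 y' := by
  have key : ∀ x x' : ℝ≥0, x ≤ x' → ∃ y y', SameRegion x x' y y' ∧ OnGrid 4 y ∧ OnGrid 4 y' := by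
    intro x x' hle
    -- The pair (x, x') arises from (0, 0) by the delay x' - x, a reset of the first clock, and the
    -- delay x. Each delay halves the mesh, from 1 to 1/2 to 1/4.
    obtain ⟨s, -, hs, hs2⟩ := (SameRegion.mk rfl rfl rfl : SameRegion 0 0 0 0).exists_delay (x' - x)
    obtain ⟨t, -, ht, ht2⟩ := hs.reset_left.exists_delay x
    have h2 : OnGrid 2 (0 + s) := by simpa using hs2 1 (OnGrid.zero 1) (OnGrid.zero 1)
    have h4 : OnGrid 4 t := ht2 2 (OnGrid.zero 2) h2
    refine ⟨0 + t, 0 + s + t, ?_, by simpa using h4, (h2.mono (by norm_num)).add h4⟩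
    simpa [tsub_add_cancel_of_le hle] using ht
  rcases le_total x x' with h | h
  · exact key x x' h
  · obtain ⟨y, y', h1, h2, h3⟩ := key x' x h
    exact ⟨y', y, h1.swap, h3, h2⟩

/-! ### Comparison of the languages of two configurations -/

namespace OneTA

variable {α : Type*} [DecidableEq α]

/-- Two automata started with clock values in the same region as given ones cannot be told apart
from them: every timed word has a counterpart, on a suitable grid. -/
theorem exists_word_of_sameRegion (A A' : OneTA α) {x x' y y' : ℝ≥0} (h : SameRegion x x' y y')
    (q q' : ℕ) (w : TimedWord α) :
    ∃ w' : TimedWord α, w'.length = w.length ∧ A.accepts q x w = A.accepts q y w' ∧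
      A'.accepts q' x' w = A'.accepts q' y' w' ∧
      (∀ c : ℕ, (∀ p ∈ w, p.1 ≤ c) → ∀ p ∈ w', p.1 ≤ c) ∧
      ∀ D, OnGrid D y → OnGrid D y' → ∀ p ∈ w', OnGrid (D * 2 ^ w.length) p.1 := by
  induction w generalizing x x' y y' q q' with
  | nil => exact ⟨[], rfl, rfl, rfl, by simp, by simp⟩
  | cons p w ih =>
    obtain ⟨t, a⟩ := p
    obtain ⟨t', ht, hs, hD⟩ := h.exists_delay t
    have hs' : SameRegion
        (if (A.step q a (reg (x + t))).2 = true then 0 else x + t)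
        (if (A'.step q' a (reg (x' + t))).2 = true then 0 else x' + t)
        (if (A.step q a (reg (x + t))).2 = true then 0 else y + t')
        (if (A'.step q' a (reg (x' + t))).2 = true then 0 else y' + t') := by
      split_ifs
      · exact ⟨rfl, rfl, rfl⟩
      · exact hs.reset_left
      · exact hs.reset_right
      · exact hs
    obtain ⟨w', hl, h1, h2, hc, hg⟩ := ih hs' (A.step q a (reg (x + t))).1
      (A'.step q' a (reg (x' + t))).1
    refine ⟨(t', a) :: w', by simp [hl], ?_, ?_, ?_, ?_⟩
    · rw [accepts, accepts, ← hs.left, h1]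
    · rw [accepts, accepts, ← hs.right, h2]
    · intro c hcw p hp
      rcases List.mem_cons.1 hp with rfl | hp
      · exact (le_natCast_iff_of_reg_eq ht c).1 (hcw _ List.mem_cons_self)
      · exact hc c (fun p hp => hcw p (List.mem_cons_of_mem _ hp)) p hp
    · intro D hy hy' p hp
      have h2D := hD D hy hy'
      have hdvd : 2 * D ∣ D * 2 ^ (w.length + 1) := ⟨2 ^ w.length, by ring⟩
      rcases List.mem_cons.1 hp with rfl | hp
      · exact h2D.mono hdvd
      · have hy2 : OnGrid (2 * D) (y + t') := (hy.mono (dvd_mul_left _ _)).add h2D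
        have hy2' : OnGrid (2 * D) (y' + t') := (hy'.mono (dvd_mul_left _ _)).add h2D
        refine (hg (2 * D) ?_ ?_ p hp).mono ⟨1, by simp only [List.length_cons]; ring⟩
        · split_ifs
          exacts [OnGrid.zero _, hy2]
        · split_ifs
          exacts [OnGrid.zero _, hy2']

/-- A word that separates the first pair of configurations has a counterpart that separates the
second. -/
theorem forall_accepts_eq_of_sameRegion (A A' : OneTA α) {x x' y y' : ℝ≥0}
    (h : SameRegion x x' y y') {q q' : ℕ} (heq : ∀ w, A.accepts q y w = A'.accepts q' y' w)
    (w : TimedWord α) : A.accepts q x w = A'.accepts q' x' w := by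
  obtain ⟨w', -, h1, h2, -⟩ := exists_word_of_sameRegion A A' h q q' w
  rw [h1, h2, heq]

/-- In an open unit interval between integers, acceptance is the same for all clock values as soon
as it is for two of them. -/
theorem accepts_congr_of_accepts_eq (A : OneTA α) {q r : ℕ} (hr : r % 2 = 1) {x x' : ℝ≥0}
    (hx : reg x = r) (hx' : reg x' = r) (hlt : x < x')
    (heq : ∀ w, A.accepts q x w = A.accepts q x' w) {y y' : ℝ≥0} (hy : reg y = r)
    (hy' : reg y' = r) (w : TimedWord α) : A.accepts q y w = A.accepts q y' w := by
  have key : ∀ {y y' : ℝ≥0}, reg y = r → reg y' = r → y < y' → ∀ w,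
      A.accepts q y w = A.accepts q y' w := by
    intro y y' hy hy' hyy
    -- The difference lies in (-1, 0), so all increasing pairs inside the interval belong to one
    -- pair region.
    have aux : ∀ {x x' : ℝ≥0}, reg x = r → reg x' = r → x < x' →
        ireg ((x : ℝ) - x') = -1 := by
      intro x x' hx hx' hlt
      obtain ⟨c, rfl⟩ : ∃ c, r = 2 * c + 1 := ⟨r / 2, by omega⟩
      have h1 := (reg_eq_two_mul_add_one.1 hx).1
      have h2 := (reg_eq_two_mul_add_one.1 hx').2
      rw [← NNReal.coe_lt_coe] at h1 h2 hlt
      push_cast at h1 h2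
      have h3 : ireg ((x : ℝ) - x') = 2 * (-1) + 1 :=
        ireg_eq_of_mem_Ioo (by push_cast; linarith) (by push_cast; linarith)
      rw [h3]
      norm_num
    exact forall_accepts_eq_of_sameRegion A A ⟨hy.trans hx.symm, hy'.trans hx'.symm,
      (aux hy hy' hyy).trans (aux hx hx' hlt).symm⟩ heq
  rcases lt_trichotomy y y' with h | h | h
  · exact key hy hy' h w
  · rw [h]
  · exact (key hy' hy h w).symm

/-- A language accepted both from a clock value and from clock value zero by some automaton is
accepted from all clock values in the same region. -/
theorem accepts_congr_of_accepts_zero_eq (A A' : OneTA α) {q q' : ℕ} {x y : ℝ≥0}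
    (hxy : reg x = reg y) (heq : ∀ w, A.accepts q x w = A'.accepts q' 0 w)
    (w : TimedWord α) : A.accepts q y w = A.accepts q x w := by
  rw [heq]
  -- When the second clock value is 0, the difference is the first value itself, so its region
  -- determines the pair region.
  exact forall_accepts_eq_of_sameRegion A A' ⟨hxy.symm, rfl, by
    simpa using (reg_eq_reg_iff.1 hxy).symm⟩ heq w

end OneTA

/-! ### Deciding whether acceptance is constant on an open region -/

/-- The lists of length at most `n` with elements from `l`. -/
def listsUpTo {β : Type*} (l : List β) : ℕ → List (List β)
  | 0 => [[]]
  | n + 1 => [] :: (listsUpTo l n).flatMap fun w => l.map fun b => b :: w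

theorem mem_listsUpTo {β : Type*} {l : List β} {n : ℕ} {w : List β} :
    w ∈ listsUpTo l n ↔ w.length ≤ n ∧ ∀ b ∈ w, b ∈ l := by
  induction n generalizing w with
  | zero => cases w <;> simp [listsUpTo]
  | succ n ih =>
    cases w with
    | nil => simp [listsUpTo]
    | cons b w =>
      simp only [listsUpTo, List.mem_cons, reduceCtorEq, false_or, List.mem_flatMap, List.mem_map,
        List.cons.injEq, ih, List.length_cons, forall_eq_or_imp]
      constructor
      · rintro ⟨v, ⟨h1, h2⟩, c, hc, rfl, rfl⟩
        exact ⟨by omega, hc, h2⟩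
      · rintro ⟨h1, hb, h2⟩
        exact ⟨w, ⟨by omega, h2⟩, b, hb, rfl, rfl⟩

/-- Region index of `n / D`. -/
def gridReg (D n : ℕ) : ℕ := n / D + (n + D - 1) / D

theorem reg_div {D : ℕ} (hD : 0 < D) (n : ℕ) : reg ((n : ℝ≥0) / D) = gridReg D n := by
  have h1 : ⌊(n : ℝ≥0) / D⌋₊ = n / D := Nat.floor_div_eq_div _ _
  have h2 : ⌈(n : ℝ≥0) / D⌉₊ = (n + D - 1) / D := by
    apply le_antisymm
    · rw [Nat.ceil_le, div_le_iff₀ (by exact_mod_cast hD)]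
      have : n ≤ (n + D - 1) / D * D := by
        have := Nat.div_add_mod (n + D - 1) D
        have := Nat.mod_lt (n + D - 1) hD
        rw [mul_comm]
        omega
      exact_mod_cast this
    · rw [← Nat.lt_succ_iff, Nat.div_lt_iff_lt_mul hD]
      have : (n : ℝ≥0) ≤ (⌈(n : ℝ≥0) / D⌉₊ : ℝ≥0) * D := by
        rw [← div_le_iff₀ (by exact_mod_cast hD)]
        exact Nat.le_ceil _
      have h3 : n ≤ ⌈(n : ℝ≥0) / D⌉₊ * D := by exact_mod_cast this
      rw [Nat.succ_mul]
      omega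
  rw [reg, h1, h2, gridReg]

theorem OnGrid.exists_eq_div {D : ℕ} (hD : 0 < D) {x : ℝ≥0} (h : OnGrid D x) :
    ∃ n : ℕ, x = (n : ℝ≥0) / D := by
  obtain ⟨n, hn⟩ := h
  refine ⟨n, ?_⟩
  rw [← hn, mul_div_cancel_left₀]
  exact_mod_cast hD.ne'

namespace OneTA

variable {α : Type*}

/-- The states of `A`, shifted by one, with the sink state `0`. -/
def states (A : OneTA α) : List ℕ := 0 :: (A.init + 1) :: A.trans.map fun θ => θ.tgt + 1

/-- A length such that states are told apart by words of at most this length if at all. -/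
def testLength (A : OneTA α) : ℕ :=
  (A.states.length * (4 * (A.maxConst + 1) + 1)) * (A.states.length * (4 * (A.maxConst + 1) + 1))

/-- The multiples of `1 / 4` up to one more than the maximum constant. -/
noncomputable def gridValues (A : OneTA α) : Finset ℝ≥0 :=
  (Finset.range (4 * (A.maxConst + 1) + 1)).image fun n : ℕ => (n : ℝ≥0) / 4

/-- The pairs of configurations with clock values in `gridValues`. -/
noncomputable def gridPairs (A : OneTA α) : Finset ((ℕ × ℝ≥0) × (ℕ × ℝ≥0)) :=
  (A.states.toFinset ×ˢ A.gridValues) ×ˢ (A.states.toFinset ×ˢ A.gridValues)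

theorem card_gridPairs_le (A : OneTA α) : A.gridPairs.card ≤ A.testLength := by
  have h1 : A.gridValues.card ≤ 4 * (A.maxConst + 1) + 1 := Finset.card_image_le.trans (by simp)
  have h2 := List.toFinset_card_le A.states
  rw [gridPairs, Finset.card_product, Finset.card_product]
  exact Nat.mul_le_mul (Nat.mul_le_mul h2 h1) (Nat.mul_le_mul h2 h1)

variable [DecidableEq α]

theorem step_mem_states (A : OneTA α) (q : ℕ) (a : α) (r : ℕ) : (A.step q a r).1 ∈ A.states := by
  unfold step states
  cases h : A.enabled q a r with
  | none => simp
  | some θ =>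
    have hm := List.mem_of_mem_head? (Option.mem_def.2 h)
    simp only [List.mem_filter] at hm
    simp only [Option.map_some, Option.getD_some, List.mem_cons, List.mem_map]
    exact Or.inr (Or.inr ⟨θ, hm.1, rfl⟩)

/-- Delays may be truncated at one more than the maximum constant. -/
theorem accepts_map_min (A : OneTA α) (q : ℕ) (x : ℝ≥0) (w : TimedWord α) :
    A.accepts q x (w.map fun p => (min p.1 ((A.maxConst + 1 : ℕ) : ℝ≥0), p.2)) =
      A.accepts q x w := by
  induction w generalizing q x with
  | nil => rfl
  | cons p w ih =>
    obtain ⟨t, a⟩ := p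
    rw [List.map_cons, accepts, accepts, ih]
    rcases le_or_gt t ((A.maxConst + 1 : ℕ) : ℝ≥0) with h | h
    · rw [min_eq_left h]
    · rw [min_eq_right h.le]
      -- The original and the truncated delay both lead above the maximum constant, where values
      -- cannot be told apart.
      have hK : (A.maxConst : ℝ≥0) < ((A.maxConst + 1 : ℕ) : ℝ≥0) := by
        exact_mod_cast Nat.lt_succ_self _
      have h1 := hK.trans_le (le_add_self (b := x))
      have h2 := (hK.trans h).trans_le (le_add_self (b := x))
      rw [step_congr_of_lt h1 h2]
      split_ifs
      · rfl
      · exact accepts_congr_of_lt h1 h2 _ _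

/-- Agreement on the timed words of length at most `n`. -/
def Agree (A : OneTA α) (n : ℕ) (q : ℕ) (x : ℝ≥0) (q' : ℕ) (x' : ℝ≥0) : Prop :=
  ∀ w : TimedWord α, w.length ≤ n → A.accepts q x w = A.accepts q' x' w

/-- One round of partition refinement: agreement at one length determines agreement at the next. -/
theorem agree_succ_iff (A : OneTA α) (n : ℕ) (q : ℕ) (x : ℝ≥0) (q' : ℕ) (x' : ℝ≥0) :
    A.Agree (n + 1) q x q' x' ↔ A.accepting q = A.accepting q' ∧ ∀ (t : ℝ≥0) (a : α),
      A.Agree n (A.step q a (reg (x + t))).1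
        (if (A.step q a (reg (x + t))).2 = true then 0 else x + t)
        (A.step q' a (reg (x' + t))).1
        (if (A.step q' a (reg (x' + t))).2 = true then 0 else x' + t) := by
  constructor
  · exact fun h => ⟨h [] (Nat.zero_le _), fun t a w hw => h ((t, a) :: w) (by simpa using hw)⟩
  · rintro ⟨h0, h⟩ w hw
    match w with
    | [] => exact h0
    | (t, a) :: w => exact h t a w (by simpa using hw)

/-- Values above K + 1 can be replaced by K + 1, and every pair region meets the grid of mesh 1/4.
The same representative serves all lengths because transported words keep their length. -/
theorem exists_gridPair (A : OneTA α) {q q' : ℕ} (hq : q ∈ A.states) (hq' : q' ∈ A.states)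
    (x x' : ℝ≥0) : ∃ p ∈ A.gridPairs, ∀ n,
      A.Agree n q x q' x' ↔ A.Agree n p.1.1 p.1.2 p.2.1 p.2.2 := by
  have hcap : ∀ x : ℝ≥0, ∃ y ≤ ((A.maxConst + 1 : ℕ) : ℝ≥0), ∀ q w,
      A.accepts q x w = A.accepts q y w := by
    intro x
    rcases le_or_gt x ((A.maxConst + 1 : ℕ) : ℝ≥0) with h | h
    · exact ⟨x, h, fun _ _ => rfl⟩
    · have hK : (A.maxConst : ℝ≥0) < ((A.maxConst + 1 : ℕ) : ℝ≥0) := by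
        exact_mod_cast Nat.lt_succ_self _
      exact ⟨_, le_rfl, fun q w => accepts_congr_of_lt (hK.trans h) hK q w⟩
  obtain ⟨y, hy, hxy⟩ := hcap x
  obtain ⟨y', hy', hxy'⟩ := hcap x'
  obtain ⟨z, z', hs, hz, hz'⟩ := exists_sameRegion_onGrid y y'
  have hmem : ∀ {y z : ℝ≥0}, y ≤ ((A.maxConst + 1 : ℕ) : ℝ≥0) → reg y = reg z → OnGrid 4 z →
      z ∈ A.gridValues := by
    intro y z hy hyz hz
    obtain ⟨n, hn⟩ := hz.exists_eq_div (by norm_num)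
    have h1 := (le_natCast_iff_of_reg_eq hyz _).1 hy
    rw [hn, div_le_iff₀ (by norm_num)] at h1
    have h2 : n ≤ (A.maxConst + 1) * 4 := by exact_mod_cast h1
    exact Finset.mem_image.2 ⟨n, Finset.mem_range.2 (by omega), by rw [hn]; norm_num⟩
  refine ⟨((q, z), (q', z')), ?_, fun n => ?_⟩
  · simp only [gridPairs, Finset.mem_product, List.mem_toFinset]
    exact ⟨⟨hq, hmem hy hs.left hz⟩, hq', hmem hy' hs.right hz'⟩
  · constructor
    · intro h w hw
      obtain ⟨w', hl, h1, h2, -⟩ := exists_word_of_sameRegion A A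
        (⟨hs.left.symm, hs.right.symm, hs.sub.symm⟩ : SameRegion z z' y y') q q' w
      rw [h1, h2, ← hxy, ← hxy']
      exact h w' (hl.trans_le hw)
    · intro h w hw
      obtain ⟨w', hl, h1, h2, -⟩ := exists_word_of_sameRegion A A hs q q' w
      rw [hxy, hxy', h1, h2]
      exact h w' (hl.trans_le hw)

/-- Configurations that agree on short words agree on all words. -/
theorem Agree.forall_accepts_eq {A : OneTA α} {q q' : ℕ} {x x' : ℝ≥0}
    (h : A.Agree A.testLength q x q' x') (hq : q ∈ A.states) (hq' : q' ∈ A.states)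
    (w : TimedWord α) : A.accepts q x w = A.accepts q' x' w := by
  classical
  -- The sets of separated grid pairs increase with the length and stay constant after the first
  -- repetition. Having at most `testLength` elements, they are constant from that length on.
  set E : ℕ → Finset ((ℕ × ℝ≥0) × (ℕ × ℝ≥0)) := fun n =>
    A.gridPairs.filter fun p => ¬ A.Agree n p.1.1 p.1.2 p.2.1 p.2.2 with hE
  have hmono : Monotone E := by
    intro m n hmn p hp
    simp only [hE, Finset.mem_filter] at hp ⊢
    exact ⟨hp.1, fun ha => hp.2 fun w hw => ha w (hw.trans hmn)⟩
  have htransfer : ∀ {m n : ℕ}, E m = E n → ∀ {q q' : ℕ} {x x' : ℝ≥0}, q ∈ A.states →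
      q' ∈ A.states → (A.Agree m q x q' x' ↔ A.Agree n q x q' x') := by
    intro m n hmn q q' x x' hq hq'
    obtain ⟨p, hp, hpn⟩ := A.exists_gridPair hq hq' x x'
    rw [hpn, hpn, ← not_iff_not]
    have := Finset.ext_iff.1 hmn p
    simpa only [hE, Finset.mem_filter, hp, true_and] using this
  have hstep : ∀ m, E m = E (m + 1) → E (m + 1) = E (m + 2) := by
    intro m hm
    ext p
    simp only [hE, Finset.mem_filter]
    refine and_congr_right fun _ => not_congr ?_
    rw [agree_succ_iff, agree_succ_iff A (m + 1)]
    exact and_congr_right fun _ => forall₂_congr fun t a =>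
      htransfer hm (A.step_mem_states _ _ _) (A.step_mem_states _ _ _)
  have hcard : ∀ {m n}, m ≤ n → (E m).card = (E n).card → E m = E n := fun hmn hc =>
    Finset.eq_of_subset_of_card_le (hmono hmn) hc.ge
  have hstab : ∀ n, A.testLength ≤ n → (E n).card = (E A.testLength).card := fun n hn =>
    Nat.stabilises_of_monotone (f := fun n => (E n).card) (b := A.testLength)
      (fun m n hmn => Finset.card_le_card (hmono hmn))
      (fun m => (Finset.card_filter_le _ _).trans A.card_gridPairs_le)
      (fun m hm => congrArg Finset.card (hstep m (hcard (Nat.le_succ m) hm))) hn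
  have hmax := le_max_left A.testLength w.length
  exact (htransfer (hcard hmax (hstab _ hmax).symm) hq hq').1 h w (le_max_right _ _)

/-- One step of `A`, with clock values and delays measured in units of `1 / D`. -/
def gridStep (A : OneTA α) (D : ℕ) (c : ℕ × ℕ) (p : ℕ × α) : ℕ × ℕ :=
  ((A.step c.1 p.2 (gridReg D (c.2 + p.1))).1,
    bif (A.step c.1 p.2 (gridReg D (c.2 + p.1))).2 then 0 else c.2 + p.1)

def gridAccepts (A : OneTA α) (D : ℕ) (c : ℕ × ℕ) (w : List (ℕ × α)) : Bool :=
  A.accepting (w.foldl (A.gridStep D) c).1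

/-- Clearing denominators turns acceptance of grid words into computation with natural numbers. -/
theorem accepts_map_div (A : OneTA α) {D : ℕ} (hD : 0 < D) (q n : ℕ) (w : List (ℕ × α)) :
    A.accepts q ((n : ℝ≥0) / D) (w.map fun p => ((p.1 : ℝ≥0) / D, p.2)) =
      A.gridAccepts D (q, n) w := by
  induction w generalizing q n with
  | nil => rfl
  | cons p w ih =>
    obtain ⟨t, a⟩ := p
    have h : (n : ℝ≥0) / D + (t : ℝ≥0) / D = ((n + t : ℕ) : ℝ≥0) / D := by
      rw [← add_div, Nat.cast_add]
    rw [List.map_cons, accepts, h, reg_div hD]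
    have h2 : (if (A.step q a (gridReg D (n + t))).2 = true then (0 : ℝ≥0)
        else ((n + t : ℕ) : ℝ≥0) / D) =
        ((bif (A.step q a (gridReg D (n + t))).2 then 0 else n + t : ℕ) : ℝ≥0) / D := by
      cases (A.step q a (gridReg D (n + t))).2 <;> simp
    rw [h2, ih]
    rfl

/-- The denominator of the clock values and delays used to compare configurations. -/
def denom (A : OneTA α) : ℕ := 4 * 2 ^ A.testLength

/-- The timed words used to compare configurations. -/
def testWords (A : OneTA α) (l : List α) : List (List (ℕ × α)) :=
  listsUpTo ((List.range ((A.maxConst + 1) * A.denom + 1)).flatMap fun n => l.map fun a => (n, a))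
    A.testLength

/-- Test whether acceptance from state `q` is the same for all clock values in the region with
odd index `r`. -/
def constOn (A : OneTA α) (l : List α) (q r : ℕ) : Bool :=
  (A.testWords l).all fun w => A.gridAccepts A.denom (q, 2 ^ A.testLength * (4 * (r / 2) + 1)) w ==
    A.gridAccepts A.denom (q, 2 ^ A.testLength * (4 * (r / 2) + 2)) w

/-- Two distinct values decide the matter for the whole interval. The values c + 1/4 and c + 1/2 lie
on the grid of mesh 1/4, so short words can be moved to multiples of 1 / `denom`. -/
theorem constOn_iff (A : OneTA α) {l : List α} (hl : ∀ a, a ∈ l) {q r : ℕ} (hr : r % 2 = 1)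
    (hq : q ∈ A.states) : A.constOn l q r = true ↔
      ∀ x y : ℝ≥0, reg x = r → reg y = r → ∀ w, A.accepts q x w = A.accepts q y w := by
  have hD : 0 < A.denom := by unfold denom; positivity
  obtain ⟨c, rfl⟩ : ∃ c, r = 2 * c + 1 := ⟨r / 2, by omega⟩
  have hc : (2 * c + 1) / 2 = c := by omega
  have hval : ∀ i : ℕ, ((2 ^ A.testLength * (4 * c + i) : ℕ) : ℝ≥0) / A.denom =
      (c : ℝ≥0) + (i : ℝ≥0) / 4 := by
    intro i
    unfold denom
    push_cast
    field_simp
  have hreg : ∀ i : ℕ, 0 < i → i < 4 → reg ((c : ℝ≥0) + (i : ℝ≥0) / 4) = 2 * c + 1 := by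
    intro i h0 h4
    refine reg_eq_two_mul_add_one.2 ⟨?_, ?_⟩
    · exact lt_add_of_pos_right _ (by positivity)
    · refine add_lt_add_right ?_ _
      rw [div_lt_one (by norm_num)]
      exact_mod_cast h4
  have h1 := hreg 1 (by norm_num) (by norm_num)
  have h2 := hreg 2 (by norm_num) (by norm_num)
  have hgrid : ∀ i : ℕ, OnGrid 4 ((c : ℝ≥0) + (i : ℝ≥0) / 4) := fun i =>
    ⟨4 * c + i, by push_cast; field_simp⟩
  simp only [constOn, List.all_eq_true, beq_iff_eq, hc]
  constructor
  · intro h x y hx hy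
    have hagree : A.Agree A.testLength q ((c : ℝ≥0) + ((1 : ℕ) : ℝ≥0) / 4) q
        ((c : ℝ≥0) + ((2 : ℕ) : ℝ≥0) / 4) := by
      intro w hw
      rw [← accepts_map_min A q _ w, ← accepts_map_min A q ((c : ℝ≥0) + ((2 : ℕ) : ℝ≥0) / 4) w]
      set v := w.map fun p => (min p.1 ((A.maxConst + 1 : ℕ) : ℝ≥0), p.2) with hv
      have hvc : ∀ p ∈ v, p.1 ≤ ((A.maxConst + 1 : ℕ) : ℝ≥0) := by
        intro p hp
        obtain ⟨p', -, rfl⟩ := List.mem_map.1 hp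
        exact min_le_right _ _
      -- The pair of values is transported to itself: only the word changes, and its delays move
      -- onto the grid while staying at most K + 1.
      obtain ⟨u, hul, hu1, hu2, huc, hug⟩ := exists_word_of_sameRegion A A
        (⟨rfl, rfl, rfl⟩ : SameRegion ((c : ℝ≥0) + ((1 : ℕ) : ℝ≥0) / 4)
          ((c : ℝ≥0) + ((2 : ℕ) : ℝ≥0) / 4) _ _) q q v
      have hlen : v.length ≤ A.testLength := by rw [hv, List.length_map]; exact hw
      have hug' : ∀ p ∈ u, ∃ n : ℕ, p.1 = (n : ℝ≥0) / A.denom := fun p hp =>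
        ((hug 4 (hgrid 1) (hgrid 2) p hp).mono
          (Nat.mul_dvd_mul_left 4 (Nat.pow_dvd_pow 2 hlen))).exists_eq_div hD
      choose! f hf using hug'
      have hu : u = (u.map fun p => (f p, p.2)).map
          fun p => ((p.1 : ℝ≥0) / A.denom, p.2) := by
        rw [List.map_map]
        conv_lhs => rw [← List.map_id u]
        apply List.map_congr_left
        intro p hp
        simp only [id, Function.comp]
        rw [← hf p hp]
      rw [hu1, hu2, hu, ← hval, ← hval, accepts_map_div A hD, accepts_map_div A hD]
      apply h
      refine mem_listsUpTo.2 ⟨by rw [List.length_map, hul]; exact hlen, ?_⟩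
      intro b hb
      obtain ⟨p, hp, rfl⟩ := List.mem_map.1 hb
      refine List.mem_flatMap.2 ⟨f p, List.mem_range.2 ?_, List.mem_map.2 ⟨p.2, hl _, rfl⟩⟩
      have := huc (A.maxConst + 1) hvc p hp
      rw [hf p hp, div_le_iff₀ (by exact_mod_cast hD)] at this
      have : f p ≤ (A.maxConst + 1) * A.denom := by exact_mod_cast this
      omega
    refine accepts_congr_of_accepts_eq A hr h1 h2 ?_ (hagree.forall_accepts_eq hq hq) hx hy
    refine add_lt_add_right ?_ _
    rw [div_lt_div_iff_of_pos_right (by norm_num)]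
    norm_num
  · intro h w _
    rw [← accepts_map_div A hD, ← accepts_map_div A hD, hval, hval]
    exact h _ _ h1 h2 _

end OneTA

/-! ### The canonical automaton -/

/-- A guard for the region with index `s ≤ 2 * K + 1`, where the index `2 * K + 1` stands for all
values above `K`. -/
def regionGuard (K s : ℕ) : Guard :=
  if s % 2 = 0 then (.eq (s / 2), []) else
    if s < 2 * K + 1 then (.gt (s / 2), [.lt (s / 2 + 1)]) else (.gt (s / 2), [])

theorem mem_regionGuard_iff {K s : ℕ} (hs : s ≤ 2 * K + 1) (x : ℝ≥0) :
    x ∈ Guard.denote (regionGuard K s) ↔ min (reg x) (2 * K + 1) = s := by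
  rw [Guard.mem_denote_iff]
  unfold regionGuard
  split_ifs <;> simp only [Guard.sat, Guard.atoms, Atom.sat, List.all_cons, List.all_nil,
    Bool.and_true, Bool.and_eq_true, decide_eq_true_eq] <;> omega

theorem const_le_of_mem_regionGuard {K s : ℕ} (hs : s ≤ 2 * K + 1) {c : Atom}
    (hc : c ∈ Guard.atoms (regionGuard K s)) : c.const ≤ K := by
  unfold regionGuard at hc
  split_ifs at hc
  · simp only [Guard.atoms, List.mem_singleton] at hc
    rw [hc, Atom.const]
    omega
  · simp only [Guard.atoms, List.mem_cons, List.not_mem_nil, or_false] at hc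
    rcases hc with rfl | rfl <;> simp only [Atom.const] <;> omega
  · simp only [Guard.atoms, List.mem_singleton] at hc
    rw [hc, Atom.const]
    omega

theorem isRegion_regionGuard {K s : ℕ} (hs : s ≤ 2 * K + 1) :
    IsRegion K (Guard.denote (regionGuard K s)) := by
  rcases Nat.even_or_odd' s with ⟨c, rfl | rfl⟩
  · refine Or.inl ⟨c, by omega, ?_⟩
    ext x
    rw [mem_regionGuard_iff hs, Set.mem_singleton_iff, ← reg_eq_two_mul]
    omega
  · by_cases hc : c < K
    · refine Or.inr (Or.inl ⟨c, hc, ?_⟩)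
      ext x
      rw [mem_regionGuard_iff hs, Set.mem_Ioo, ← reg_eq_two_mul_add_one]
      omega
    · refine Or.inr (Or.inr ?_)
      ext x
      rw [mem_regionGuard_iff hs, Set.mem_Ioi, ← two_mul_lt_reg]
      omega

/-- Two distinct clock values just above zero that are driven by the delay `t` to the open unit
interval that contains or follows `t`. -/
theorem exists_small_pair (t : ℝ≥0) : ∃ e e' : ℝ≥0, e < e' ∧ reg e = 1 ∧ reg e' = 1 ∧
    reg (e + t) = 2 * (reg t / 2) + 1 ∧ reg (e' + t) = 2 * (reg t / 2) + 1 := by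
  have hf : reg t / 2 = ⌊t⌋₊ := by
    have h1 := Nat.floor_le_ceil t
    have h2 := Nat.ceil_le_floor_add_one t
    unfold reg
    omega
  have hlt : t < (⌊t⌋₊ : ℝ≥0) + 1 := Nat.lt_floor_add_one t
  have hle : (⌊t⌋₊ : ℝ≥0) ≤ t := Nat.floor_le zero_le
  obtain ⟨b, hb1, hb2⟩ := exists_between hlt
  obtain ⟨a, ha1, ha2⟩ := exists_between hb1
  have hta := tsub_add_cancel_of_le ha1.le
  have htb := tsub_add_cancel_of_le hb1.le
  have hone : ∀ z, t < z → z < (⌊t⌋₊ : ℝ≥0) + 1 → reg (z - t) = 1 := by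
    intro z h1 h2
    refine (reg_eq_two_mul_add_one (c := 0)).2 ⟨by simpa using h1, ?_⟩
    refine lt_of_add_lt_add_right (a := t) ?_
    rw [tsub_add_cancel_of_le h1.le, Nat.cast_zero, zero_add, add_comm]
    exact h2.trans_le (add_le_add_left hle 1)
  refine ⟨a - t, b - t, ?_, hone a ha1 (ha2.trans hb2), hone b hb1 hb2, ?_, ?_⟩
  · exact lt_of_add_lt_add_right (a := t) (by rwa [hta, htb])
  · rw [hta, hf]
    exact reg_eq_two_mul_add_one.2 ⟨hle.trans_lt ha1, ha2.trans hb2⟩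
  · rw [htb, hf]
    exact reg_eq_two_mul_add_one.2 ⟨hle.trans_lt hb1, hb2⟩

/-- Region index reached from the region with index `r` (whose values are taken to be close to
its infimum) by a delay in the region with index `s`. -/
def shiftReg (r s : ℕ) : ℕ := r + if r % 2 = 0 then s else 2 * (s / 2)

namespace OneTA

variable {α : Type*}

theorem Run.congr_trans {A A' : OneTA α} (h : A.trans = A'.trans) {q q' : ℕ} {x x' : ℝ≥0}
    {w : TimedWord α} (hr : A.Run q x w q' x') : A'.Run q x w q' x' := by
  induction hr with
  | nil => exact .nil _ _
  | cons θ q ν t a w _ _ mem hsrc hletter sat _ ih =>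
    exact .cons θ q ν t a w _ _ (h ▸ mem) hsrc hletter sat ih

variable [DecidableEq α]

/-- The language accepted from state `q` with clock value `x`. -/
def langFrom (A : OneTA α) (q : ℕ) (x : ℝ≥0) : Set (TimedWord α) := {w | A.accepts q x w = true}

theorem langFrom_eq_iff {A A' : OneTA α} {q q' : ℕ} {x x' : ℝ≥0} :
    A.langFrom q x = A'.langFrom q' x' ↔ ∀ w, A.accepts q x w = A'.accepts q' x' w := by
  constructor
  · exact fun h w => Bool.eq_iff_iff.2 (Set.ext_iff.1 h w)
  · exact fun h => Set.ext fun w => Bool.eq_iff_iff.1 (h w)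

theorem residual_langFrom (A : OneTA α) (q : ℕ) (x t : ℝ≥0) (a : α) :
    residual (A.langFrom q x) [(t, a)] = A.langFrom (A.step q a (reg (x + t))).1
      (if (A.step q a (reg (x + t))).2 = true then 0 else x + t) := rfl

theorem Deterministic.lang_eq {A : OneTA α} (hA : A.Deterministic) :
    A.lang = A.langFrom (A.init + 1) 0 :=
  Set.ext hA.mem_lang_iff

/-- Sufficient test for the language accepted from state `q` with a clock value in the region with
index `r` to be recognizable. -/
def resettable (A : OneTA α) (l : List α) (q r : ℕ) : Bool :=
  decide (r % 2 = 0) || decide (2 * A.maxConst + 1 ≤ r) || A.constOn l q r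

/-- The transition of the canonical automaton from the state for `c` with letter `a` and the region
with index `s`. The pair `c` consists of a state of `A` and the index of the region of the clock of
`A` when the clock of the canonical automaton was last reset. -/
def canonTransition (A : OneTA α) (l : List α) (c : ℕ × ℕ) (a : α) (s : ℕ) : Transition α where
  src := Nat.pair c.1 c.2
  tgt := Nat.pair (A.step c.1 a (min (shiftReg c.2 s) (2 * A.maxConst + 1))).1
    (bif (A.step c.1 a (min (shiftReg c.2 s) (2 * A.maxConst + 1))).2 then 0 else
      bif A.resettable l (A.step c.1 a (min (shiftReg c.2 s) (2 * A.maxConst + 1))).1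
        (min (shiftReg c.2 s) (2 * A.maxConst + 1))
      then min (shiftReg c.2 s) (2 * A.maxConst + 1) else c.2)
  letter := a
  guard := regionGuard A.maxConst s
  reset := (A.step c.1 a (min (shiftReg c.2 s) (2 * A.maxConst + 1))).2 ||
    A.resettable l (A.step c.1 a (min (shiftReg c.2 s) (2 * A.maxConst + 1))).1
      (min (shiftReg c.2 s) (2 * A.maxConst + 1))

/-- The canonical automaton, which resets its clock whenever the residual language is recognizable.
The list `l` enumerates the alphabet. -/
def canon (l : List α) (A : OneTA α) : OneTA α where
  init := Nat.pair (A.init + 1) 0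
  trans := A.states.flatMap fun q => (List.range (2 * A.maxConst + 2)).flatMap fun r =>
    l.flatMap fun a => (List.range (2 * A.maxConst + 2)).map fun s =>
      A.canonTransition l (q, r) a s
  final := A.final.flatMap fun q => (List.range (2 * A.maxConst + 2)).map fun r =>
    Nat.pair (q + 1) r

theorem mem_canon_trans {A : OneTA α} {l : List α} {θ : Transition α} :
    θ ∈ (canon l A).trans ↔ ∃ q ∈ A.states, ∃ r ≤ 2 * A.maxConst + 1, ∃ a ∈ l,
      ∃ s ≤ 2 * A.maxConst + 1, A.canonTransition l (q, r) a s = θ := by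
  simp only [canon, List.mem_flatMap, List.mem_map, List.mem_range,
    show ∀ n, n < 2 * A.maxConst + 2 ↔ n ≤ 2 * A.maxConst + 1 from fun n => Nat.lt_succ_iff]

theorem mem_canon_final {A : OneTA α} {l : List α} {q r : ℕ} (hr : r ≤ 2 * A.maxConst + 1) :
    Nat.pair q r ∈ (canon l A).final ↔ A.accepting q = true := by
  simp only [canon, List.mem_flatMap, List.mem_map, List.mem_range, Nat.pair_eq_pair, accepting,
    decide_eq_true_eq]
  constructor
  · rintro ⟨f, hf, r', -, h, -⟩
    exact ⟨f, hf, h⟩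
  · rintro ⟨f, hf, h⟩
    exact ⟨f, hf, r, by omega, h, rfl⟩

theorem canon_deterministic (A : OneTA α) (l : List α) : (canon l A).Deterministic := by
  intro θ hθ θ' hθ' hne
  obtain ⟨q, -, r, -, a, -, s, hs, rfl⟩ := mem_canon_trans.1 hθ
  obtain ⟨q', -, r', -, a', -, s', hs', rfl⟩ := mem_canon_trans.1 hθ'
  by_cases h1 : Nat.pair q r = Nat.pair q' r'
  · by_cases h2 : a = a'
    · refine Or.inr (Or.inr (Set.eq_empty_of_forall_notMem ?_))
      rintro x ⟨hx, hx'⟩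
      have e1 := (mem_regionGuard_iff hs x).1 hx
      have e2 := (mem_regionGuard_iff hs' x).1 hx'
      rw [Nat.pair_eq_pair] at h1
      exact hne (by rw [h1.1, h1.2, h2, ← e1, ← e2])
    · exact Or.inr (Or.inl h2)
  · exact Or.inl h1

theorem canon_maxConst (A : OneTA α) {l : List α} (hl : ∀ a, a ∈ l) :
    (canon l A).maxConst = A.maxConst := by
  apply le_antisymm
  · have key : ∀ (m : List ℕ) (K : ℕ), (∀ n ∈ m, n ≤ K) → m.foldr max 0 ≤ K := by
      intro m K h
      induction m with
      | nil => simp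
      | cons n m ih =>
        exact max_le (h n List.mem_cons_self) (ih fun k hk => h k (List.mem_cons_of_mem _ hk))
    apply key
    intro n hn
    obtain ⟨θ, hθ, hn⟩ := List.mem_flatMap.1 hn
    obtain ⟨c, hc, rfl⟩ := List.mem_map.1 hn
    obtain ⟨q, -, r, -, a, -, s, hs, rfl⟩ := mem_canon_trans.1 hθ
    exact const_le_of_mem_regionGuard hs hc
  -- Without transitions the constant is 0. Otherwise some letter exists, and the sink has a
  -- transition on it guarded by x = K, so the constant K does occur.
  · cases htr : A.trans with
    | nil => simp [maxConst, constants, htr]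
    | cons θ T =>
      have hmem : A.canonTransition l (0, 0) θ.letter (2 * A.maxConst) ∈ (canon l A).trans :=
        mem_canon_trans.2 ⟨0, by simp [states], 0, Nat.zero_le _, θ.letter, hl _, _,
          Nat.le_succ _, rfl⟩
      refine const_le_maxConst hmem (c := .eq A.maxConst) ?_
      simp [canonTransition, regionGuard, Guard.atoms]

theorem canon_regionGuarded (A : OneTA α) {l : List α} (hl : ∀ a, a ∈ l) :
    (canon l A).RegionGuarded := by
  intro θ hθ
  rw [canon_maxConst A hl]
  obtain ⟨q, -, r, -, a, -, s, hs, rfl⟩ := mem_canon_trans.1 hθ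
  exact isRegion_regionGuard hs

/-! ### Correctness of the canonical automaton -/

/-- The state `p` of the canonical automaton of `A`, with clock value `y`, represents the language
`L`. -/
def Represents (A : OneTA α) (p : ℕ) (y : ℝ≥0) (L : Set (TimedWord α)) : Prop :=
  ∃ q ∈ A.states, ∃ r ≤ 2 * A.maxConst + 1, p = Nat.pair q r ∧
    (y = 0 ∨ ∃ c < A.maxConst, reg y = 2 * c + 1) ∧
    ((∃ c : ℕ, r = 2 * c ∧ L = A.langFrom q (c + y)) ∨
      (r % 2 = 1 ∧ y = 0 ∧ ∀ x, min (reg x) (2 * A.maxConst + 1) = r → L = A.langFrom q x))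

theorem Represents.mem_final_iff {A : OneTA α} {l : List α} {p : ℕ} {y : ℝ≥0}
    {L : Set (TimedWord α)} (h : A.Represents p y L) : p ∈ (canon l A).final ↔ [] ∈ L := by
  obtain ⟨q, -, r, hr, rfl, -, ⟨c, -, rfl⟩ | ⟨hodd, -, hL⟩⟩ := h
  · exact mem_canon_final hr
  · rw [mem_canon_final hr]
    obtain ⟨c, rfl⟩ : ∃ c, r = 2 * c + 1 := ⟨r / 2, by omega⟩
    -- A value inside the remembered region is needed to use `hL`; acceptance of the empty word
    -- depends only on the state.
    obtain ⟨e, -, -, he, -, -⟩ := exists_small_pair 0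
    rw [hL (c + e) (by rw [reg_natCast_add, he]; omega)]
    rfl

/-- The canonical automaton follows residual languages, and resets its clock unless the residual
language depends on the clock value of `A` inside an open unit interval. -/
theorem Represents.exists_transition {A : OneTA α} {l : List α} (hl : ∀ a, a ∈ l) {p : ℕ}
    {y : ℝ≥0} {L : Set (TimedWord α)} (h : A.Represents p y L) (t : ℝ≥0) (a : α) :
    ∃ θ ∈ (canon l A).trans, θ.src = p ∧ θ.letter = a ∧ y + t ∈ Guard.denote θ.guard ∧
      A.Represents θ.tgt (θ.update (y + t)) (residual L [(t, a)]) ∧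
      (θ.reset = false → ∃ q ∈ A.states, ∃ x, reg x % 2 = 1 ∧ A.constOn l q (reg x) = false ∧
        residual L [(t, a)] = A.langFrom q x) := by
  obtain ⟨q, hq, r₀, hr₀, rfl, hy, hL⟩ := h
  set K := A.maxConst with hK
  obtain ⟨s, hs⟩ : ∃ s, min (reg (y + t)) (2 * K + 1) = s := ⟨_, rfl⟩
  obtain ⟨r, hr⟩ : ∃ r, min (shiftReg r₀ s) (2 * K + 1) = r := ⟨_, rfl⟩
  have hsK : s ≤ 2 * K + 1 := hs ▸ min_le_right _ _
  have hrK : r ≤ 2 * K + 1 := hr ▸ min_le_right _ _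
  -- Here x is a clock value of A that fits the state. Over an integer it is c + y. Over an open
  -- region two values near the infimum are chosen which the delay t drives into the same region,
  -- the one computed by `shiftReg`.
  obtain ⟨x, hLx, hxr, hpar⟩ : ∃ x, L = A.langFrom q x ∧ min (reg (x + t)) (2 * K + 1) = r ∧
      ((∃ c : ℕ, r₀ = 2 * c ∧ x = c + y) ∨ (∃ x', x < x' ∧ L = A.langFrom q x' ∧
        reg (x + t) = reg (x' + t))) := by
    rcases hL with ⟨c, rfl, hLc⟩ | ⟨hodd, rfl, hLc⟩
    · refine ⟨c + y, hLc, ?_, Or.inl ⟨c, rfl, rfl⟩⟩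
      rw [add_assoc, reg_natCast_add]
      rw [shiftReg, if_pos (by omega)] at hr
      omega
    · obtain ⟨c, rfl⟩ : ∃ c, r₀ = 2 * c + 1 := ⟨r₀ / 2, by omega⟩
      obtain ⟨e, e', hlt, he, he', het, het'⟩ := exists_small_pair t
      have hreg : reg ((c : ℝ≥0) + e + t) = 2 * c + (2 * (reg t / 2) + 1) := by
        rw [add_assoc, reg_natCast_add, het]
      refine ⟨c + e, hLc _ (by rw [reg_natCast_add, he]; omega), ?_, Or.inr ⟨c + e',
        add_lt_add_right hlt _, hLc _ (by rw [reg_natCast_add, he']; omega), ?_⟩⟩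
      · rw [hreg]
        rw [shiftReg, if_neg (by omega)] at hr
        rw [zero_add] at hs
        omega
      · rw [hreg, add_assoc, reg_natCast_add, het']
  clear hL hy
  set P := A.step q a r with hP
  have hstep : A.step q a (reg (x + t)) = P := by rw [hP, ← hxr, hK, step_min]
  have hres : residual L [(t, a)] = A.langFrom P.1 (if P.2 = true then 0 else x + t) := by
    rw [hLx, residual_langFrom, hstep]
  have hPmem : P.1 ∈ A.states := A.step_mem_states _ _ _
  have hθ : A.canonTransition l (q, r₀) a s ∈ (canon l A).trans :=
    mem_canon_trans.2 ⟨q, hq, r₀, hr₀, a, hl a, s, hsK, rfl⟩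
  refine ⟨_, hθ, rfl, rfl, (mem_regionGuard_iff hsK _).2 hs, ?_⟩
  have htgt : (A.canonTransition l (q, r₀) a s).tgt = Nat.pair P.1
      (bif P.2 then 0 else bif A.resettable l P.1 r then r else r₀) := by
    simp only [canonTransition, ← hK, hr, ← hP]
  have hreset : (A.canonTransition l (q, r₀) a s).reset = (P.2 || A.resettable l P.1 r) := by
    simp only [canonTransition, ← hK, hr, ← hP]
  rw [Transition.update, htgt, hreset, hres]
  cases hP2 : P.2 with
  | true =>
    simp only [Bool.true_or, cond_true, if_true, Bool.true_eq_false, false_implies, and_true]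
    exact ⟨P.1, hPmem, 0, Nat.zero_le _, rfl, Or.inl rfl, Or.inl ⟨0, rfl, by simp⟩⟩
  | false =>
    cases hRes : A.resettable l P.1 r with
    | true =>
      simp only [Bool.or_true, cond_true, cond_false, if_true, Bool.true_eq_false, false_implies,
        and_true, Bool.false_eq_true, if_false]
      refine ⟨P.1, hPmem, r, hrK, rfl, Or.inl rfl, ?_⟩
      clear hpar
      -- For even r the clock of A is exactly the integer c. For odd r its value is irrelevant,
      -- either because it exceeds K or by the constancy test.
      rcases Nat.even_or_odd' r with ⟨c, hc | hc⟩
      · refine Or.inl ⟨c, hc, ?_⟩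
        rw [add_zero, ← reg_eq_two_mul.1 (by omega : reg (x + t) = 2 * c)]
      · refine Or.inr ⟨by omega, rfl, fun z hz => langFrom_eq_iff.2 ?_⟩
        by_cases hcK : r = 2 * K + 1
        · exact accepts_congr_of_lt (two_mul_lt_reg.1 (by omega)) (two_mul_lt_reg.1 (by omega)) _
        · have hconst : A.constOn l P.1 r = true := by
            simp only [resettable, Bool.or_eq_true, decide_eq_true_eq] at hRes
            rcases hRes with (h | h) | h
            · omega
            · omega
            · exact h
          exact (constOn_iff A hl (by omega) hPmem).1 hconst _ _ (by omega) (by omega)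
    | false =>
      simp only [Bool.or_false, cond_false, if_false, Bool.false_eq_true, true_implies]
      simp only [resettable, Bool.or_eq_false_iff, decide_eq_false_iff_not] at hRes
      obtain ⟨⟨h1, h2⟩, h3⟩ := hRes
      have hxreg : reg (x + t) = r := by clear hpar; omega
      have hodd : r % 2 = 1 := by clear hpar; omega
      have hlt : r < 2 * K + 1 := by clear hpar; omega
      refine ⟨?_, P.1, hPmem, x + t, hxreg ▸ hodd, hxreg ▸ h3, rfl⟩
      rcases hpar with ⟨c, hc, rfl⟩ | ⟨x', hxx, hLx', hregx'⟩
      · rw [add_assoc, reg_natCast_add] at hxreg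
        refine ⟨P.1, hPmem, r₀, hr₀, rfl, Or.inr ⟨reg (y + t) / 2, by omega, by omega⟩,
          Or.inl ⟨c, hc, by rw [add_assoc]⟩⟩
      -- Two distinct values in one open interval would accept the same residual, so the language
      -- would be constant there, against the failed test. Hence a state with an open remembered
      -- region always resets in its next step.
      · exfalso
        have hres' : residual L [(t, a)] = A.langFrom P.1 (x' + t) := by
          rw [hLx', residual_langFrom, ← hregx', hstep, hP2]
          simp
        rw [hres, hP2] at hres'
        have heq := langFrom_eq_iff.1 hres'
        refine absurd ((constOn_iff A hl hodd hPmem).2 fun y y' hy hy' =>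
          accepts_congr_of_accepts_eq A hodd hxreg (hregx' ▸ hxreg)
            (add_lt_add_left hxx t) heq hy hy') ?_
        rw [h3]
        simp

theorem Represents.exists_run {A : OneTA α} {l : List α} (hl : ∀ a, a ∈ l) {p : ℕ}
    {y : ℝ≥0} {L : Set (TimedWord α)} (h : A.Represents p y L) (w : TimedWord α) :
    ∃ p' y', (canon l A).Run p y w p' y' ∧ (p' ∈ (canon l A).final ↔ w ∈ L) := by
  induction w generalizing p y L with
  | nil => exact ⟨p, y, .nil _ _, h.mem_final_iff⟩
  | cons b w ih =>
    obtain ⟨t, a⟩ := b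
    obtain ⟨θ, hθ, hsrc, hletter, hsat, hrep, -⟩ := h.exists_transition hl t a
    obtain ⟨p', y', hr, hf⟩ := ih hrep
    exact ⟨p', y', .cons θ _ _ _ _ _ _ _ hθ hsrc hletter hsat hr, hf⟩

theorem Represents.mem_iff {A : OneTA α} {l : List α} (hl : ∀ a, a ∈ l) {p : ℕ}
    {y : ℝ≥0} {L : Set (TimedWord α)} (h : A.Represents p y L) (w : TimedWord α) :
    (∃ q ∈ (canon l A).final, ∃ x : ℝ≥0, (canon l A).Run p y w q x) ↔ w ∈ L := by
  obtain ⟨p', y', hr, hf⟩ := h.exists_run hl w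
  rw [← hf]
  constructor
  · rintro ⟨q, hq, x, hr'⟩
    rw [((canon_deterministic A l).run_unique hr hr').1]
    exact hq
  · exact fun hp => ⟨p', hp, y', hr⟩

/-- Since the clock is 0, `p` can be made the initial state of the canonical automaton. -/
theorem Represents.recognizable {A : OneTA α} {l : List α} (hl : ∀ a, a ∈ l) {p : ℕ}
    {L : Set (TimedWord α)} (h : A.Represents p 0 L) : Recognizable L := by
  refine ⟨{ canon l A with init := p }, canon_deterministic A l, ?_⟩
  ext w
  rw [← h.mem_iff hl]
  exact exists_congr fun q => and_congr_right fun _ => exists_congr fun x =>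
    ⟨Run.congr_trans (by rfl), Run.congr_trans (by rfl)⟩

/-- A language that depends on the clock value inside an open unit interval is not recognizable. -/
theorem not_recognizable_langFrom {A : OneTA α} {l : List α} (hl : ∀ a, a ∈ l) {q : ℕ}
    (hq : q ∈ A.states) {x : ℝ≥0} (hx : reg x % 2 = 1) (hc : A.constOn l q (reg x) = false) :
    ¬ Recognizable (A.langFrom q x) := by
  rintro ⟨D, hD, hlang⟩
  rw [hD.lang_eq, eq_comm, langFrom_eq_iff] at hlang
  refine absurd ((constOn_iff A hl hx hq).2 fun y y' hy hy' w => ?_) (by rw [hc]; simp)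
  -- The recognizer `D` starts with clock value 0, so agreement with it at x spreads to the whole
  -- region of x.
  rw [accepts_congr_of_accepts_zero_eq A D hy.symm hlang,
    accepts_congr_of_accepts_zero_eq A D hy'.symm hlang]

/-- Resets happen exactly at recognizable residuals: after a reset the residual is represented with
clock value 0, and without one it varies inside an open interval. The invariant at the end of the
run is kept because it bounds the clock value. -/
theorem Represents.exists_run_synResetFrom {A : OneTA α} {l : List α} (hl : ∀ a, a ∈ l) {p : ℕ}
    {y : ℝ≥0} {L : Set (TimedWord α)} (h : A.Represents p y L) (w : TimedWord α) :
    ∃ p', (canon l A).Run p y w p' (synResetFrom L y w) ∧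
      ∃ L', A.Represents p' (synResetFrom L y w) L' := by
  induction w generalizing p y L with
  | nil => exact ⟨p, .nil _ _, L, h⟩
  | cons b w ih =>
    obtain ⟨t, a⟩ := b
    obtain ⟨θ, hθ, hsrc, hletter, hsat, hrep, hnr⟩ := h.exists_transition hl t a
    have hupd : (open Classical in if Recognizable (residual L [(t, a)]) then 0 else y + t) =
        θ.update (y + t) := by
      cases hreset : θ.reset with
      | true =>
        simp only [Transition.update, hreset, if_true] at hrep ⊢
        rw [if_pos (hrep.recognizable hl)]
      | false =>
        obtain ⟨q, hq, x, hx, hc, hres⟩ := hnr hreset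
        simp only [Transition.update, hreset, Bool.false_eq_true, if_false]
        rw [hres, if_neg (not_recognizable_langFrom hl hq hx hc)]
    obtain ⟨p', hr, L', hL'⟩ := ih hrep
    refine ⟨p', ?_, L', ?_⟩
    · rw [synResetFrom]
      dsimp only
      rw [hupd]
      exact .cons θ _ _ _ _ _ _ _ hθ hsrc hletter hsat hr
    · rw [synResetFrom]
      dsimp only
      rw [hupd]
      exact hL'

theorem Deterministic.represents_init {A : OneTA α} (hA : A.Deterministic) (l : List α) :
    A.Represents (canon l A).init 0 A.lang :=
  ⟨A.init + 1, by simp [states], 0, Nat.zero_le _, rfl, Or.inl rfl,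
    Or.inl ⟨0, rfl, by simpa using hA.lang_eq⟩⟩

theorem Represents.mem_Icc_diff {A : OneTA α} {p : ℕ} {y : ℝ≥0} {L : Set (TimedWord α)}
    (h : A.Represents p y L) : y ∈ Set.Icc (0 : ℝ≥0) (A.maxConst : ℝ≥0) \
      {x : ℝ≥0 | ∃ n : ℕ, 0 < n ∧ x = (n : ℝ≥0)} := by
  obtain ⟨q, -, r, -, -, rfl | ⟨c, hc, hy⟩, -⟩ := h
  · refine ⟨⟨le_rfl, zero_le⟩, ?_⟩
    rintro ⟨n, hn, h⟩
    exact hn.ne (by exact_mod_cast h)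
  · refine ⟨⟨zero_le, (reg_lt_two_mul.1 (by omega)).le⟩, ?_⟩
    rintro ⟨n, -, rfl⟩
    rw [reg_natCast] at hy
    omega

end OneTA

/-! ### Primitive recursiveness of the construction -/

theorem primrec_two_pow : Primrec fun n : ℕ => 2 ^ n :=
  ((Primrec₂.unpaired'.1 Nat.Primrec.pow).comp (Primrec.const 2) Primrec.id :)

theorem primrec_list_all {β γ : Type*} [Primcodable β] [Primcodable γ] {f : γ → List β}
    {p : γ → β → Bool} (hf : Primrec f) (hp : Primrec₂ p) :
    Primrec fun c => (f c).all (p c) := by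
  refine (Primrec.list_foldr hf (Primrec.const true)
    (h := fun c b => p c b.1 && b.2) ?_).of_eq fun c => ?_
  · exact (Primrec.and.comp (hp.comp Primrec.fst (Primrec.fst.comp Primrec.snd))
      (Primrec.snd.comp Primrec.snd)).to₂
  · induction f c with
    | nil => rfl
    | cons b l ih => rw [List.foldr_cons, ih, List.all_cons]

theorem primrec_list_filter {β γ : Type*} [Primcodable β] [Primcodable γ] {f : γ → List β}
    {p : γ → β → Bool} (hf : Primrec f) (hp : Primrec₂ p) :
    Primrec fun c => (f c).filter (p c) := by
  refine (Primrec.list_foldr hf (Primrec.const [])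
    (h := fun c b => bif p c b.1 then b.1 :: b.2 else b.2) ?_).of_eq fun c => ?_
  · exact (Primrec.cond (hp.comp Primrec.fst (Primrec.fst.comp Primrec.snd))
      (Primrec.list_cons.comp (Primrec.fst.comp Primrec.snd) (Primrec.snd.comp Primrec.snd))
      (Primrec.snd.comp Primrec.snd)).to₂
  · induction f c with
    | nil => rfl
    | cons b l ih => rw [List.foldr_cons, ih]; cases h : p c b <;> simp [h]

theorem primrec_listsUpTo {β : Type*} [Primcodable β] : Primrec₂ (listsUpTo (β := β)) := by
  refine (Primrec.nat_rec (f := fun _ : List β => [[]])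
    (g := fun l b => [] :: b.2.flatMap fun w => l.map fun c => c :: w) (Primrec.const _) ?_).of_eq
    fun l n => ?_
  · refine (Primrec.list_cons.comp (Primrec.const []) (Primrec.list_flatMap
      (Primrec.snd.comp Primrec.snd) (Primrec.list_map (Primrec.fst.comp Primrec.fst)
        (Primrec.list_cons.comp Primrec.snd (Primrec.snd.comp Primrec.fst)).to₂).to₂)).to₂
  · induction n with
    | zero => rfl
    | succ n ih => rw [listsUpTo, ← ih]

theorem primrec_gridReg : Primrec₂ gridReg := by
  refine Primrec.nat_add.comp₂ (Primrec.nat_div.comp₂ Primrec₂.right Primrec₂.left)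
    (Primrec.nat_div.comp₂ (Primrec.nat_sub.comp₂ (Primrec.nat_add.comp₂ Primrec₂.right
      Primrec₂.left) (Primrec₂.const 1)) Primrec₂.left)

theorem primrec_shiftReg : Primrec₂ shiftReg := by
  refine Primrec.nat_add.comp₂ Primrec₂.left (Primrec.ite
    (Primrec.eq.comp (Primrec.nat_mod.comp Primrec.fst (Primrec.const 2)) (Primrec.const 0))
    Primrec.snd (Primrec.nat_mul.comp (Primrec.const 2)
      (Primrec.nat_div.comp Primrec.snd (Primrec.const 2))))

theorem primrec_atom_equiv : Primrec Atom.equivSum := Primrec.of_equiv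

theorem primrec_atom_gt : Primrec Atom.gt :=
  (Primrec.of_equiv_symm (e := Atom.equivSum)).comp Primrec.sumInl

theorem primrec_atom_eq : Primrec Atom.eq :=
  (Primrec.of_equiv_symm (e := Atom.equivSum)).comp (Primrec.sumInr.comp Primrec.sumInl)

theorem primrec_atom_lt : Primrec Atom.lt :=
  (Primrec.of_equiv_symm (e := Atom.equivSum)).comp (Primrec.sumInr.comp Primrec.sumInr)

theorem primrec_atom_const : Primrec Atom.const := by
  refine (Primrec.sumCasesOn (h := fun _ s => Sum.casesOn (motive := fun _ => ℕ) s id id)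
    primrec_atom_equiv Primrec₂.right
    (Primrec.sumCasesOn Primrec.snd Primrec₂.right Primrec₂.right).to₂).of_eq fun c => ?_
  cases c <;> rfl

theorem primrec_atom_sat : Primrec₂ Atom.sat := by
  have hd : ∀ {γ : Type} [Primcodable γ] {f : γ → ℕ}, Primrec f →
      Primrec fun c => 2 * f c := fun hf => Primrec.nat_mul.comp (Primrec.const 2) hf
  refine (Primrec.sumCasesOn
    (g := fun (p : Atom × ℕ) c => decide (2 * c < p.2))
    (h := fun (p : Atom × ℕ) s => Sum.casesOn (motive := fun _ => Bool) s
      (fun c => decide (p.2 = 2 * c)) (fun c => decide (p.2 < 2 * c)))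
    (primrec_atom_equiv.comp Primrec.fst)
    (Primrec.nat_lt.decide.comp (hd Primrec.snd) (Primrec.snd.comp Primrec.fst)).to₂
    (Primrec.sumCasesOn Primrec.snd
      (Primrec.eq.decide.comp (Primrec.snd.comp (Primrec.fst.comp Primrec.fst))
        (hd Primrec.snd)).to₂
      (Primrec.nat_lt.decide.comp (Primrec.snd.comp (Primrec.fst.comp Primrec.fst))
        (hd Primrec.snd)).to₂).to₂).of_eq fun p => ?_
  obtain ⟨c, r⟩ := p
  cases c <;> rfl

theorem primrec_guard_atoms : Primrec Guard.atoms :=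
  Primrec.list_cons.comp Primrec.fst Primrec.snd

theorem primrec_guard_sat : Primrec₂ Guard.sat :=
  primrec_list_all (primrec_guard_atoms.comp Primrec.fst)
    (primrec_atom_sat.comp Primrec.snd (Primrec.snd.comp Primrec.fst)).to₂

theorem primrec_regionGuard : Primrec₂ regionGuard := by
  have h2 : Primrec fun p : ℕ × ℕ => p.2 / 2 := Primrec.nat_div.comp Primrec.snd (Primrec.const 2)
  refine Primrec.ite
    (Primrec.eq.comp (Primrec.nat_mod.comp Primrec.snd (Primrec.const 2)) (Primrec.const 0))
    (Primrec.pair (primrec_atom_eq.comp h2) (Primrec.const [])) (Primrec.ite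
      (Primrec.nat_lt.comp Primrec.snd (Primrec.succ.comp
        (Primrec.nat_mul.comp (Primrec.const 2) Primrec.fst)))
      (Primrec.pair (primrec_atom_gt.comp h2) (Primrec.list_cons.comp
        (primrec_atom_lt.comp (Primrec.succ.comp h2)) (Primrec.const [])))
      (Primrec.pair (primrec_atom_gt.comp h2) (Primrec.const [])))

section

variable {α : Type*} [Primcodable α]

theorem primrec_transition_equiv : Primrec (Transition.equivProd α) := Primrec.of_equiv

theorem primrec_src : Primrec (Transition.src (α := α)) :=
  Primrec.fst.comp primrec_transition_equiv

theorem primrec_tgt : Primrec (Transition.tgt (α := α)) :=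
  Primrec.fst.comp (Primrec.snd.comp primrec_transition_equiv)

theorem primrec_letter : Primrec (Transition.letter (α := α)) :=
  Primrec.fst.comp (Primrec.snd.comp (Primrec.snd.comp primrec_transition_equiv))

theorem primrec_guard : Primrec (Transition.guard (α := α)) :=
  Primrec.fst.comp (Primrec.snd.comp (Primrec.snd.comp (Primrec.snd.comp primrec_transition_equiv)))

theorem primrec_reset : Primrec (Transition.reset (α := α)) :=
  Primrec.snd.comp (Primrec.snd.comp (Primrec.snd.comp (Primrec.snd.comp primrec_transition_equiv)))

theorem primrec_transition_mk {γ : Type*} [Primcodable γ] {src tgt : γ → ℕ} {letter : γ → α}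
    {guard : γ → Guard} {reset : γ → Bool} (h₁ : Primrec src) (h₂ : Primrec tgt)
    (h₃ : Primrec letter) (h₄ : Primrec guard) (h₅ : Primrec reset) :
    Primrec fun c => Transition.mk (src c) (tgt c) (letter c) (guard c) (reset c) :=
  (Primrec.of_equiv_symm (e := Transition.equivProd α)).comp
    (h₁.pair (h₂.pair (h₃.pair (h₄.pair h₅))))

namespace OneTA

theorem primrec_equiv : Primrec (OneTA.equivProd α) := Primrec.of_equiv

theorem primrec_init : Primrec (OneTA.init (α := α)) := Primrec.fst.comp primrec_equiv

theorem primrec_trans : Primrec (OneTA.trans (α := α)) :=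
  Primrec.fst.comp (Primrec.snd.comp primrec_equiv)

theorem primrec_final : Primrec (OneTA.final (α := α)) :=
  Primrec.snd.comp (Primrec.snd.comp primrec_equiv)

theorem primrec_mk {γ : Type*} [Primcodable γ] {init : γ → ℕ} {trans : γ → List (Transition α)}
    {final : γ → List ℕ} (h₁ : Primrec init) (h₂ : Primrec trans) (h₃ : Primrec final) :
    Primrec fun c => OneTA.mk (init c) (trans c) (final c) :=
  (Primrec.of_equiv_symm (e := OneTA.equivProd α)).comp (h₁.pair (h₂.pair h₃))

theorem primrec_maxConst : Primrec (maxConst (α := α)) := by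
  refine Primrec.list_foldr (Primrec.list_flatMap primrec_trans (Primrec.list_map
    (primrec_guard_atoms.comp (primrec_guard.comp Primrec.snd))
    (primrec_atom_const.comp Primrec.snd).to₂).to₂) (Primrec.const 0)
    (Primrec.nat_max.comp (Primrec.fst.comp Primrec.snd) (Primrec.snd.comp Primrec.snd)).to₂

theorem primrec_states : Primrec (states (α := α)) :=
  Primrec.list_cons.comp (Primrec.const 0) (Primrec.list_cons.comp
    (Primrec.succ.comp primrec_init) (Primrec.list_map primrec_trans
      (Primrec.succ.comp (primrec_tgt.comp Primrec.snd)).to₂))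

theorem primrec_testLength : Primrec (testLength (α := α)) := by
  have h : Primrec fun A : OneTA α => A.states.length * (4 * (A.maxConst + 1) + 1) :=
    Primrec.nat_mul.comp (Primrec.list_length.comp primrec_states) (Primrec.succ.comp
      (Primrec.nat_mul.comp (Primrec.const 4) (Primrec.succ.comp primrec_maxConst)))
  exact Primrec.nat_mul.comp h h

theorem primrec_accepting : Primrec₂ (accepting (α := α)) := by
  refine (PrimrecRel.comp (PrimrecRel.exists_mem_list (Primrec.eq (α := ℕ)))
    (Primrec.list_map (primrec_final.comp Primrec.fst) (Primrec.succ.comp Primrec.snd).to₂)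
    Primrec.snd).decide.of_eq fun p => ?_
  simp [accepting]

theorem primrec_denom : Primrec (denom (α := α)) :=
  Primrec.nat_mul.comp (Primrec.const 4) (primrec_two_pow.comp primrec_testLength)

theorem primrec_testWords (l : List α) : Primrec fun A : OneTA α => A.testWords l :=
  primrec_listsUpTo.comp (Primrec.list_flatMap
    (Primrec.list_range.comp (Primrec.succ.comp (Primrec.nat_mul.comp
      (Primrec.succ.comp primrec_maxConst) primrec_denom)))
    (Primrec.list_map (Primrec.const l) (Primrec.pair (Primrec.snd.comp Primrec.fst)
      Primrec.snd).to₂).to₂) primrec_testLength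

variable [DecidableEq α]

theorem primrec_enabled :
    Primrec fun c : OneTA α × ℕ × α × ℕ => c.1.enabled c.2.1 c.2.2.1 c.2.2.2 := by
  have hq : Primrec fun d : (OneTA α × ℕ × α × ℕ) × Transition α => d.1.2.1 :=
    Primrec.fst.comp (Primrec.snd.comp Primrec.fst)
  have ha : Primrec fun d : (OneTA α × ℕ × α × ℕ) × Transition α => d.1.2.2.1 :=
    Primrec.fst.comp (Primrec.snd.comp (Primrec.snd.comp Primrec.fst))
  have hr : Primrec fun d : (OneTA α × ℕ × α × ℕ) × Transition α => d.1.2.2.2 :=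
    Primrec.snd.comp (Primrec.snd.comp (Primrec.snd.comp Primrec.fst))
  have hsrc : Primrec fun d : (OneTA α × ℕ × α × ℕ) × Transition α => d.2.src + 1 :=
    Primrec.succ.comp (primrec_src.comp Primrec.snd)
  have hsat : Primrec fun d : (OneTA α × ℕ × α × ℕ) × Transition α =>
      Guard.sat d.2.guard d.1.2.2.2 :=
    primrec_guard_sat.comp (primrec_guard.comp Primrec.snd) hr
  have hp : PrimrecPred fun d : (OneTA α × ℕ × α × ℕ) × Transition α =>
      (d.2.src + 1 = d.1.2.1 ∧ d.2.letter = d.1.2.2.1) ∧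
        Guard.sat d.2.guard d.1.2.2.2 = true :=
    ((Primrec.eq.comp hsrc hq).and (Primrec.eq.comp (primrec_letter.comp Primrec.snd) ha)).and
      (Primrec.eq.comp hsat (Primrec.const true))
  have hfilter := primrec_list_filter
    (f := fun c : OneTA α × ℕ × α × ℕ => c.1.trans)
    (p := fun c θ => decide ((θ.src + 1 = c.2.1 ∧ θ.letter = c.2.2.1) ∧
      Guard.sat θ.guard c.2.2.2 = true)) (primrec_trans.comp Primrec.fst) hp.decide
  exact Primrec.list_head?.comp hfilter

theorem primrec_step :
    Primrec fun c : OneTA α × ℕ × α × ℕ => c.1.step c.2.1 c.2.2.1 c.2.2.2 :=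
  Primrec.option_getD.comp (Primrec.option_map primrec_enabled
    (Primrec.pair (Primrec.succ.comp (primrec_tgt.comp Primrec.snd))
      (primrec_reset.comp Primrec.snd)).to₂) (Primrec.const (0, true))

theorem primrec_gridStep :
    Primrec fun c : OneTA α × ℕ × (ℕ × ℕ) × ℕ × α => c.1.gridStep c.2.1 c.2.2.1 c.2.2.2 := by
  have h2 : Primrec fun c : OneTA α × ℕ × (ℕ × ℕ) × ℕ × α => c.2.2.1 :=
    Primrec.fst.comp (Primrec.snd.comp Primrec.snd)
  have h3 : Primrec fun c : OneTA α × ℕ × (ℕ × ℕ) × ℕ × α => c.2.2.2 :=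
    Primrec.snd.comp (Primrec.snd.comp Primrec.snd)
  have hsum := Primrec.nat_add.comp (Primrec.snd.comp h2) (Primrec.fst.comp h3)
  have hstep := primrec_step.comp (Primrec.pair Primrec.fst (Primrec.pair (Primrec.fst.comp h2)
    (Primrec.pair (Primrec.snd.comp h3) (primrec_gridReg.comp
      (Primrec.fst.comp Primrec.snd) hsum))))
  exact Primrec.pair (Primrec.fst.comp hstep)
    (Primrec.cond (Primrec.snd.comp hstep) (Primrec.const 0) hsum)

theorem primrec_gridAccepts :
    Primrec fun c : OneTA α × ℕ × (ℕ × ℕ) × List (ℕ × α) =>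
      c.1.gridAccepts c.2.1 c.2.2.1 c.2.2.2 := by
  have hA : Primrec fun d : (OneTA α × ℕ × (ℕ × ℕ) × List (ℕ × α)) × (ℕ × ℕ) × ℕ × α => d.1.1 :=
    Primrec.fst.comp Primrec.fst
  have hD : Primrec fun d : (OneTA α × ℕ × (ℕ × ℕ) × List (ℕ × α)) × (ℕ × ℕ) × ℕ × α => d.1.2.1 :=
    Primrec.fst.comp (Primrec.snd.comp Primrec.fst)
  have hstep : Primrec fun d : (OneTA α × ℕ × (ℕ × ℕ) × List (ℕ × α)) × (ℕ × ℕ) × ℕ × α =>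
      d.1.1.gridStep d.1.2.1 d.2.1 d.2.2 :=
    (primrec_gridStep.comp (hA.pair (hD.pair Primrec.snd)) :)
  have hfold := Primrec.list_foldl
    (f := fun c : OneTA α × ℕ × (ℕ × ℕ) × List (ℕ × α) => c.2.2.2)
    (g := fun c => c.2.2.1) (h := fun c b => c.1.gridStep c.2.1 b.1 b.2)
    (Primrec.snd.comp (Primrec.snd.comp Primrec.snd))
    (Primrec.fst.comp (Primrec.snd.comp Primrec.snd)) hstep
  exact primrec_accepting.comp Primrec.fst (Primrec.fst.comp hfold)

theorem primrec_constOn (l : List α) :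
    Primrec fun c : OneTA α × ℕ × ℕ => c.1.constOn l c.2.1 c.2.2 := by
  have hval : ∀ i : ℕ, Primrec fun c : OneTA α × ℕ × ℕ =>
      2 ^ c.1.testLength * (4 * (c.2.2 / 2) + i) := by
    intro i
    have h1 : Primrec fun c : OneTA α × ℕ × ℕ => 2 ^ c.1.testLength :=
      primrec_two_pow.comp (primrec_testLength.comp Primrec.fst)
    have h2 : Primrec fun c : OneTA α × ℕ × ℕ => c.2.2 / 2 :=
      Primrec.nat_div.comp (Primrec.snd.comp Primrec.snd) (Primrec.const 2)
    exact Primrec.nat_mul.comp h1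
      (Primrec.nat_add.comp (Primrec.nat_mul.comp (Primrec.const 4) h2) (Primrec.const i))
  have hacc : ∀ f : OneTA α × ℕ × ℕ → ℕ, Primrec f →
      Primrec fun d : (OneTA α × ℕ × ℕ) × List (ℕ × α) =>
        d.1.1.gridAccepts d.1.1.denom (d.1.2.1, f d.1) d.2 := by
    intro f hf
    have hA : Primrec fun d : (OneTA α × ℕ × ℕ) × List (ℕ × α) => d.1.1 :=
      Primrec.fst.comp Primrec.fst
    have hD : Primrec fun d : (OneTA α × ℕ × ℕ) × List (ℕ × α) => d.1.1.denom :=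
      primrec_denom.comp hA
    have hq : Primrec fun d : (OneTA α × ℕ × ℕ) × List (ℕ × α) => d.1.2.1 :=
      Primrec.fst.comp (Primrec.snd.comp Primrec.fst)
    have hf' : Primrec fun d : (OneTA α × ℕ × ℕ) × List (ℕ × α) => f d.1 := hf.comp Primrec.fst
    exact (primrec_gridAccepts.comp (hA.pair (hD.pair ((hq.pair hf').pair Primrec.snd))) :)
  have hbeq := Primrec.beq.comp (hacc _ (hval 1)) (hacc _ (hval 2))
  have hw : Primrec fun c : OneTA α × ℕ × ℕ => c.1.testWords l :=
    (primrec_testWords l).comp Primrec.fst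
  exact primrec_list_all hw hbeq.to₂

theorem primrec_resettable (l : List α) :
    Primrec fun c : OneTA α × ℕ × ℕ => c.1.resettable l c.2.1 c.2.2 := by
  have hr : Primrec fun c : OneTA α × ℕ × ℕ => c.2.2 := Primrec.snd.comp Primrec.snd
  exact Primrec.or.comp (Primrec.or.comp
    (Primrec.eq.comp (Primrec.nat_mod.comp hr (Primrec.const 2)) (Primrec.const 0)).decide
    (Primrec.nat_le.comp (Primrec.succ.comp (Primrec.nat_mul.comp (Primrec.const 2)
      (primrec_maxConst.comp Primrec.fst))) hr).decide) (primrec_constOn l)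

theorem primrec_canonTransition (l : List α) :
    Primrec fun c : OneTA α × (ℕ × ℕ) × α × ℕ => c.1.canonTransition l c.2.1 c.2.2.1 c.2.2.2 := by
  have hq : Primrec fun c : OneTA α × (ℕ × ℕ) × α × ℕ => c.2.1.1 :=
    Primrec.fst.comp (Primrec.fst.comp Primrec.snd)
  have hr : Primrec fun c : OneTA α × (ℕ × ℕ) × α × ℕ => c.2.1.2 :=
    Primrec.snd.comp (Primrec.fst.comp Primrec.snd)
  have ha : Primrec fun c : OneTA α × (ℕ × ℕ) × α × ℕ => c.2.2.1 :=
    Primrec.fst.comp (Primrec.snd.comp Primrec.snd)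
  have hs : Primrec fun c : OneTA α × (ℕ × ℕ) × α × ℕ => c.2.2.2 :=
    Primrec.snd.comp (Primrec.snd.comp Primrec.snd)
  have hK : Primrec fun c : OneTA α × (ℕ × ℕ) × α × ℕ => c.1.maxConst :=
    primrec_maxConst.comp Primrec.fst
  have hr' := Primrec.nat_min.comp (primrec_shiftReg.comp hr hs)
    (Primrec.succ.comp (Primrec.nat_mul.comp (Primrec.const 2) hK))
  have hstep := primrec_step.comp (Primrec.pair Primrec.fst (Primrec.pair hq
    (Primrec.pair ha hr')))
  have hres := (primrec_resettable l).comp (Primrec.pair Primrec.fst (Primrec.pair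
    (Primrec.fst.comp hstep) hr'))
  exact primrec_transition_mk (Primrec₂.natPair.comp hq hr)
    (Primrec₂.natPair.comp (Primrec.fst.comp hstep) (Primrec.cond (Primrec.snd.comp hstep)
      (Primrec.const 0) (Primrec.cond hres hr' hr))) ha (primrec_regionGuard.comp hK hs)
    (Primrec.or.comp (Primrec.snd.comp hstep) hres)

theorem primrec_canon (l : List α) : Primrec (canon l) := by
  have hrange : Primrec fun A : OneTA α => List.range (2 * A.maxConst + 2) :=
    Primrec.list_range.comp (Primrec.nat_add.comp (Primrec.nat_mul.comp (Primrec.const 2)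
      primrec_maxConst) (Primrec.const 2))
  have hinit : Primrec fun A : OneTA α => Nat.pair (A.init + 1) 0 :=
    Primrec₂.natPair.comp (Primrec.succ.comp primrec_init) (Primrec.const 0)
  -- The nested enumerations are treated from the inside out; each level adds its variable to a
  -- context of products nested to the left.
  have h₁ : Primrec fun d : ((OneTA α × ℕ) × ℕ) × α =>
      (List.range (2 * d.1.1.1.maxConst + 2)).map fun s =>
        d.1.1.1.canonTransition l (d.1.1.2, d.1.2) d.2 s := by
    have hA : Primrec fun d : (((OneTA α × ℕ) × ℕ) × α) × ℕ => d.1.1.1.1 :=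
      Primrec.fst.comp (Primrec.fst.comp (Primrec.fst.comp Primrec.fst))
    have hq : Primrec fun d : (((OneTA α × ℕ) × ℕ) × α) × ℕ => d.1.1.1.2 :=
      Primrec.snd.comp (Primrec.fst.comp (Primrec.fst.comp Primrec.fst))
    have hr : Primrec fun d : (((OneTA α × ℕ) × ℕ) × α) × ℕ => d.1.1.2 :=
      Primrec.snd.comp (Primrec.fst.comp Primrec.fst)
    have ha : Primrec fun d : (((OneTA α × ℕ) × ℕ) × α) × ℕ => d.1.2 :=
      Primrec.snd.comp Primrec.fst
    have ht : Primrec fun d : (((OneTA α × ℕ) × ℕ) × α) × ℕ =>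
        d.1.1.1.1.canonTransition l (d.1.1.1.2, d.1.1.2) d.1.2 d.2 :=
      ((primrec_canonTransition l).comp (hA.pair ((hq.pair hr).pair (ha.pair Primrec.snd))) :)
    exact Primrec.list_map
      (hrange.comp (Primrec.fst.comp (Primrec.fst.comp Primrec.fst))) ht.to₂
  have h₂ : Primrec fun d : (OneTA α × ℕ) × ℕ => l.flatMap fun a =>
      (List.range (2 * d.1.1.maxConst + 2)).map fun s =>
        d.1.1.canonTransition l (d.1.2, d.2) a s :=
    Primrec.list_flatMap (Primrec.const l) h₁.to₂
  have h₃ : Primrec fun d : OneTA α × ℕ => (List.range (2 * d.1.maxConst + 2)).flatMap fun r =>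
      l.flatMap fun a => (List.range (2 * d.1.maxConst + 2)).map fun s =>
        d.1.canonTransition l (d.2, r) a s :=
    Primrec.list_flatMap (hrange.comp Primrec.fst) h₂.to₂
  have h₄ : Primrec fun d : OneTA α × ℕ =>
      (List.range (2 * d.1.maxConst + 2)).map fun r => Nat.pair (d.2 + 1) r :=
    Primrec.list_map (hrange.comp Primrec.fst) (Primrec₂.natPair.comp
      (Primrec.succ.comp (Primrec.snd.comp Primrec.fst)) Primrec.snd).to₂
  exact primrec_mk hinit (Primrec.list_flatMap primrec_states h₃.to₂)
    (Primrec.list_flatMap primrec_final h₄.to₂)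

end OneTA

end
end OneClock

theorem theorem1 {α : Type*} [Finite α] [Primcodable α] :
    (∃ f : OneClock.OneTA α → OneClock.OneTA α, Computable f ∧
      ∀ A : OneClock.OneTA α, A.Deterministic →
        (f A).Deterministic ∧ (f A).Complete ∧ (f A).RegionGuarded ∧
        (f A).lang = A.lang ∧
        (f A).maxConst = A.maxConst ∧
        (f A).Induces (OneClock.synReset A.lang)) ∧
    (∀ L : Set (OneClock.TimedWord α), OneClock.Recognizable L →
      ∀ u : OneClock.TimedWord α,
        OneClock.synReset L u ∈
          Set.Icc (0 : NNReal) (OneClock.minConst L : NNReal) \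
            {x : NNReal | ∃ n : ℕ, 0 < n ∧ x = (n : NNReal)}) := by
  classical
  have := Fintype.ofFinite α
  obtain ⟨l, hl⟩ : ∃ l : List α, ∀ a, a ∈ l := ⟨Finset.univ.toList, by simp⟩
  refine ⟨⟨OneClock.OneTA.canon l, (OneClock.OneTA.primrec_canon l).to_comp, fun A hA => ?_⟩,
    fun L hL u => ?_⟩
  · have h := hA.represents_init l
    refine ⟨A.canon_deterministic l, fun w => ?_, A.canon_regionGuarded hl, ?_,
      A.canon_maxConst hl, fun u => ?_⟩
    · obtain ⟨p, y, hr, -⟩ := h.exists_run hl w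
      exact ⟨p, y, hr⟩
    · exact Set.ext (h.mem_iff hl)
    · obtain ⟨p, hr, -⟩ := h.exists_run_synResetFrom hl u
      exact ⟨p, hr⟩
  · obtain ⟨A₀, hA₀, hL₀⟩ := hL
    -- The least constant is attained, and the syntactic reset function depends only on the
    -- language, so an automaton with this constant gives the sharp bound.
    obtain ⟨A, hA, rfl, hK⟩ : OneClock.minConst L ∈ {K : ℕ | ∃ A : OneClock.OneTA α,
        A.Deterministic ∧ A.lang = L ∧ A.maxConst = K} :=
      Nat.sInf_mem ⟨_, A₀, hA₀, hL₀, rfl⟩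
    obtain ⟨p, -, L', hL'⟩ := (hA.represents_init l).exists_run_synResetFrom hl u
    rw [← hK]
    exact hL'.mem_Icc_diff
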